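/- All graphs are finite, simple and undirected. A bipartite graph is \emph{chordal bipartite} if every induced cycle in it has length four. An \emph{LBFS ordering} of a graph $G$ is a vertex ordering $\sigma(1),\dots,\sigma(|V(G)|)$ that can be produced as follows: all vertices start with the label $\emptyset$; in step $i=1,2,\dots$ an arbitrary unnumbered vertex $v$ is chosen as $\sigma(i)$ such that no unnumbered vertex $y$ satisfies $\mathrm{label}(v)\prec\mathrm{label}(y)$, and then $i$ is added to the label of every unnumbered neighbor of $v$. Here $A\prec B$ means that $A\subsetneq B$ or $\min(A\setminus B)>\min(B\setminus A)$. The \emph{end-vertex problem of LBFS} asks, given a graph $G$ and a vertex $t$ of $G$, whether $t$ is the last vertex of some LBFS ordering of $G$. \textbf{Corollary.} On connected chordal bipartite graphs $G$, the end-vertex problem of LBFS can be solved in time $O(|V(G)|^4)$. Precisely: there are a single word RAM program and constants $k$ and $C$ such that, for every connected chordal bipartite graph $G$ with vertex set $\{0,\dots,n-1\}$, every vertex $t$ of $G$, and every word length $w$ that is at least $k$ times the bit length of $n$, the program, started with $n$, $t$ and the adjacency matrix of $G$ in its memory (all other cells being $0$), halts after at most $C\,n^4$ steps and accepts if and only if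 $t$ is the last vertex of some LBFS ordering of $G$. Arithmetic is modulo $2^w$, and each constant, register or memory access, arithmetic operation or comparison, write and test takes one step. -/

import Mathlib

/-! ### Graphs and searches -/

/-- A chordal bipartite graph: a bipartite graph all of whose induced cycles have length four. -/
def IsChordalBipartite {V : Type*} (G : SimpleGraph V) : Prop :=
  G.IsBipartite ∧
    ∀ k : ℕ, 3 ≤ k → Nonempty (SimpleGraph.cycleGraph k ↪g G) → k = 4

/-- A strict comparison of labels; labels are sets of positive integers. -/
abbrev LabelOrder := Set ℕ → Set ℕ → Prop

/-- The label order of lexicographic breadth first search: `A` is smaller than `B` if `A` is a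
proper subset of `B` or `min (A \ B) > min (B \ A)`. -/
def lbfsOrder : LabelOrder := fun A B =>
  A ⊂ B ∨ ∃ a b, IsLeast (A \ B) a ∧ IsLeast (B \ A) b ∧ b < a

/-- The label of a vertex `v` that is still unnumbered when the (zero-based) position `i` of the
ordering `σ` is to be filled: the set of the numbers (counted from `1`) given so far to
neighbors of `v`. -/
def searchLabel {V : Type*} {n : ℕ} (G : SimpleGraph V) (σ : Fin n ≃ V) (i : Fin n) (v : V) :
    Set ℕ :=
  {m | ∃ j : Fin n, j < i ∧ G.Adj (σ j) v ∧ m = (j : ℕ) + 1}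

/-- `v` may be chosen for position `i`: it is unnumbered, and no unnumbered vertex has a
larger label. -/
def IsEligible {V : Type*} {n : ℕ} (lt : LabelOrder) (G : SimpleGraph V) (σ : Fin n ≃ V)
    (i : Fin n) (v : V) : Prop :=
  i ≤ σ.symm v ∧
    ¬ ∃ y : V, i ≤ σ.symm y ∧ lt (searchLabel G σ i v) (searchLabel G σ i y)

/-- `σ` is a possible output of the label search defined by `lt` on the graph `G`. -/
def IsLabelSearchOrdering {V : Type*} {n : ℕ} (lt : LabelOrder) (G : SimpleGraph V)
    (σ : Fin n ≃ V) : Prop :=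
  ∀ i : Fin n, IsEligible lt G σ i (σ i)

/-- The vertex ordering `σ` is an LBFS ordering of `G`. -/
def IsLBFSOrdering {V : Type*} {n : ℕ} (G : SimpleGraph V) (σ : Fin n ≃ V) : Prop :=
  IsLabelSearchOrdering lbfsOrder G σ

/-- The question of the end-vertex problem of LBFS: is `t` the last vertex of some LBFS ordering
of `G`? -/
def IsLBFSEndVertex {n : ℕ} (G : SimpleGraph (Fin n)) (t : Fin n) : Prop :=
  ∃ σ : Fin n ≃ Fin n, IsLBFSOrdering G σ ∧ ∀ v, σ.symm v ≤ σ.symm t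

/-! ### The word RAM

A random access machine with structured control. A program is a fixed finite piece of text; it
refers to finitely many registers and finitely many memory banks by their (constant) names. The
cells of a bank are addressed by computed values. With word length `w`, all arithmetic is carried
out on words, that is, modulo `2 ^ w`. -/
namespace WordRAM

/-- Binary word operations. Subtraction is truncated at `0`; comparisons yield `1` or `0`. -/
inductive BinOp
  | add | sub | mul | lt | eq

/-- The result of a binary operation on words of length `w`. -/
def BinOp.eval (w : ℕ) : BinOp → ℕ → ℕ → ℕ
  | .add, a, b => (a + b) % 2 ^ w
  | .sub, a, b => a - b
  | .mul, a, b => (a * b) % 2 ^ w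
  | .lt, a, b => if a < b then 1 % 2 ^ w else 0
  | .eq, a, b => if a = b then 1 % 2 ^ w else 0

/-- Expressions: constants, register contents, contents of the memory cell of a bank at a computed
address, and binary operations. -/
inductive Expr
  | const (c : ℕ)
  | reg (r : ℕ)
  | load (bank : ℕ) (addr : Expr)
  | op (o : BinOp) (e₁ e₂ : Expr)

/-- Programs. The tests of `ite` and `while` succeed if the value of the expression is nonzero. -/
inductive Prog
  | skip
  | assign (r : ℕ) (e : Expr)
  | store (bank : ℕ) (addr e : Expr)
  | seq (p q : Prog)
  | ite (e : Expr) (p q : Prog)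
  | while (e : Expr) (p : Prog)

/-- The contents of the registers and of the memory banks. -/
@[ext] structure State where
  reg : ℕ → ℕ
  mem : ℕ → ℕ → ℕ

/-- The value of an expression. -/
def Expr.eval (w : ℕ) (s : State) : Expr → ℕ
  | .const c => c % 2 ^ w
  | .reg r => s.reg r
  | .load b a => s.mem b (a.eval w s)
  | .op o e₁ e₂ => o.eval w (e₁.eval w s) (e₂.eval w s)

/-- The time for evaluating an expression: one step for each constant, register access, memory
access and operation in it. -/
def Expr.cost : Expr → ℕ
  | .const _ => 1
  | .reg _ => 1
  | .load _ a => a.cost + 1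
  | .op _ e₁ e₂ => e₁.cost + e₂.cost + 1

/-- Write `x` to register `r`. -/
def State.setReg (s : State) (r x : ℕ) : State :=
  { s with reg := Function.update s.reg r x }

/-- Write `x` to the cell with address `a` of the bank `b`. -/
def State.setMem (s : State) (b a x : ℕ) : State :=
  { s with mem := Function.update s.mem b (Function.update (s.mem b) a x) }

/-- `Exec w p s s' T`: with word length `w`, the program `p` started in the state `s` halts in the
state `s'` after exactly `T` steps. -/
inductive Exec (w : ℕ) : Prog → State → State → ℕ → Prop
  | skip (s : State) : Exec w .skip s s 1
  | assign (r : ℕ) (e : Expr) (s : State) :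
      Exec w (.assign r e) s (s.setReg r (e.eval w s)) (e.cost + 1)
  | store (b : ℕ) (a e : Expr) (s : State) :
      Exec w (.store b a e) s (s.setMem b (a.eval w s) (e.eval w s)) (a.cost + e.cost + 1)
  | seq {p q : Prog} {s s' s'' : State} {T T' : ℕ} :
      Exec w p s s' T → Exec w q s' s'' T' → Exec w (.seq p q) s s'' (T + T')
  | ite_true {e : Expr} {p q : Prog} {s s' : State} {T : ℕ} :
      e.eval w s ≠ 0 → Exec w p s s' T → Exec w (.ite e p q) s s' (e.cost + 1 + T)
  | ite_false {e : Expr} {p q : Prog} {s s' : State} {T : ℕ} :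
      e.eval w s = 0 → Exec w q s s' T → Exec w (.ite e p q) s s' (e.cost + 1 + T)
  | while_true {e : Expr} {p : Prog} {s s' s'' : State} {T T' : ℕ} :
      e.eval w s ≠ 0 → Exec w p s s' T → Exec w (.while e p) s' s'' T' →
        Exec w (.while e p) s s'' (e.cost + 1 + T + T')
  | while_false {e : Expr} {p : Prog} {s : State} :
      e.eval w s = 0 → Exec w (.while e p) s s (e.cost + 1)

end WordRAM

open Classical in
/-- The initial state for the instance `(G, t)`: register `0` holds the number `n` of vertices,
register `1` holds the vertex `t`, and bank `0` holds the adjacency matrix of `G` row by row (the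
entry for `u`, `v` is at address `u * n + v`). Everything else is `0`. -/
noncomputable def graphInput {n : ℕ} (G : SimpleGraph (Fin n)) (t : Fin n) : WordRAM.State where
  reg r := if r = 0 then n else if r = 1 then t else 0
  mem b a := if b = 0 ∧ ∃ u v : Fin n, G.Adj u v ∧ a = (u : ℕ) * n + v then 1 else 0

/-! Fix the first vertex `r` of a search. An LBFS ordering visits the distance layers of `r` one
after the other. A bipartite graph has no edges inside a layer, so two vertices of a layer are
ordered by their parents, the neighbors one layer closer to `r`: the vertex owning the earliest
private parent comes first (`PrecedesByParents.lt`), and vertices with equal parent sets may be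
ordered at will (`BreaksTiesBy.lt`). Thus `t` must lie in the last layer and lose there against
everyone else.

Chordal bipartiteness makes this decidable layer by layer. Two ancestors of a common vertex that lie
in one layer have nested parent sets (`isParent_chain`); otherwise a path above and a path below
them close up to an induced cycle of length at least six. Hence among the parents of `a` that are
not parents of `b`, one with the most parents, say `x`, dominates all others; let `y` be its
counterpart for `b`. If one side has no private parents, inclusion decides, equality counting as a
win for `a`. Otherwise `Comparison` passes to `x` and `y`, one layer up.

Both verdicts are sound. If `x` loses, then `y` precedes every private parent of `a` in every
ordering starting with `r` (`Comparison.precedes_of_false`). Conversely, a single tie-breaking rule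
realizes all wins against ancestors of `t` simultaneously: prefer vertices with few children among
the ancestors of `t` (`Comparison.precedes_of_true`).

The program tries all `n` roots. For each it computes distances in cubic time and compares every
vertex of the layer of `t` with `t`; a comparison climbs at most `n` layers, with two linear scans
per layer. This is cubic per root. Uniqueness of the verdict is never needed: the program derives
some verdict, and either one is sound. -/

namespace SimpleGraph

/-! ### Induced paths and induced cycles -/

variable {V : Type*} {G : SimpleGraph V}

/-- A shortest walk, viewed as a sequence of vertices, is an induced path. -/
theorem Reachable.exists_induced_path {p q : V} (h : G.Reachable p q) :
    ∃ f : ℕ → V, f 0 = p ∧ f (G.dist p q) = q ∧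
      (∀ i j, i ≤ G.dist p q → j ≤ G.dist p q → (G.Adj (f i) (f j) ↔ i + 1 = j ∨ j + 1 = i)) ∧
      ∀ i j, i ≤ G.dist p q → j ≤ G.dist p q → f i = f j → i = j := by
  obtain ⟨W, hW⟩ := h.exists_walk_length_eq_dist
  -- The distance from `p` recovers the index along a shortest walk; this gives both injectivity and
  -- the absence of chords.
  have hd : ∀ i, i ≤ G.dist p q → G.dist p (W.getVert i) = i := by
    intro i hi
    have h1 : G.dist p (W.getVert i) ≤ i :=
      (dist_le (W.take i)).trans (by rw [Walk.take_length]; omega)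
    have h2 : G.dist (W.getVert i) q ≤ G.dist p q - i :=
      (dist_le (W.drop i)).trans (by rw [Walk.drop_length]; omega)
    have h3 : G.dist p q ≤ G.dist p (W.getVert i) + G.dist (W.getVert i) q :=
      Reachable.dist_triangle_left ⟨W.take i⟩ q
    omega
  have key : ∀ i j, i < j → j ≤ G.dist p q →
      (G.Adj (W.getVert i) (W.getVert j) ↔ i + 1 = j) := by
    intro i j hij hj
    constructor
    · intro ha
      have := ha.diff_dist_adj (u := p)
      rw [hd i (by omega), hd j hj] at this
      omega
    · rintro rfl
      exact W.adj_getVert_succ (by omega)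
  refine ⟨W.getVert, W.getVert_zero, by rw [← hW]; exact W.getVert_length, ?_, ?_⟩
  · intro i j hi hj
    rcases lt_trichotomy i j with hij | rfl | hij
    · rw [key i j hij hj]; omega
    · simp
    · rw [adj_comm, key j i hij hi]; omega
  · intro i j hi hj hij
    rw [← hd i hi, hij, hd j hj]

/-- Two induced paths that are joined exactly by the edges between their ends form an induced
cycle. -/
theorem cycleGraph_embedding_of_two_paths {f g : ℕ → V} {m l : ℕ} (hm : 0 < m) (hl : 0 < l)
    (hf : ∀ i j, i ≤ m → j ≤ m → (G.Adj (f i) (f j) ↔ i + 1 = j ∨ j + 1 = i))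
    (hg : ∀ i j, i ≤ l → j ≤ l → (G.Adj (g i) (g j) ↔ i + 1 = j ∨ j + 1 = i))
    (hf' : ∀ i j, i ≤ m → j ≤ m → f i = f j → i = j)
    (hg' : ∀ i j, i ≤ l → j ≤ l → g i = g j → i = j)
    (hfg : ∀ i j, i ≤ m → j ≤ l → f i ≠ g j)
    (hadj : ∀ i j, i ≤ m → j ≤ l → (G.Adj (f i) (g j) ↔ (i = m ∧ j = 0) ∨ (i = 0 ∧ j = l))) :
    Nonempty (cycleGraph (m + l + 2) ↪g G) := by
  -- Run through `f`, then through `g`; the closing edge joins the last vertex of `g` to `f 0`.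
  set h : ℕ → V := fun i => if i ≤ m then f i else g (i - (m + 1)) with hh
  have key : ∀ i j, i < j → j < m + l + 2 →
      (G.Adj (h i) (h j) ↔ i + 1 = j ∨ (i = 0 ∧ j = m + l + 1)) := by
    intro i j hij hj
    by_cases h1 : j ≤ m
    · simp only [hh, h1, if_true, show i ≤ m by omega]
      rw [hf i j (by omega) h1]; omega
    · by_cases h2 : i ≤ m
      · simp only [hh, h1, if_false, h2, if_true]
        rw [hadj i _ h2 (by omega)]; omega
      · simp only [hh, h1, if_false, h2]
        rw [hg _ _ (by omega) (by omega)]; omega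
  have hne : ∀ i j, i < j → j < m + l + 2 → h i ≠ h j := by
    intro i j hij hj
    by_cases h1 : j ≤ m
    · simp only [hh, h1, if_true, show i ≤ m by omega]
      intro e; have := hf' i j (by omega) h1 e; omega
    · by_cases h2 : i ≤ m
      · simp only [hh, h1, if_false, h2, if_true]
        exact hfg _ _ h2 (by omega)
      · simp only [hh, h1, if_false, h2]
        intro e; have := hg' _ _ (by omega) (by omega) e; omega
  have hcyc : ∀ i j : Fin (m + l + 2), i < j →
      ((cycleGraph (m + l + 2)).Adj i j ↔ (i : ℕ) + 1 = j ∨ ((i : ℕ) = 0 ∧ (j : ℕ) = m + l + 1)) := by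
    intro i j hij
    rw [cycleGraph_adj', Fin.coe_sub_iff_lt.2 hij, Fin.coe_sub_iff_le.2 hij.le]
    have : (i : ℕ) < j := hij
    omega
  refine ⟨⟨⟨fun i => h i, ?_⟩, ?_⟩⟩
  · intro i j e
    rcases lt_trichotomy i j with hij | hij | hij
    · exact absurd e (hne i j hij j.2)
    · exact hij
    · exact absurd e.symm (hne j i hij i.2)
  · intro i j
    change G.Adj (h i) (h j) ↔ _
    rcases lt_trichotomy i j with hij | rfl | hij
    · rw [key i j hij j.2, hcyc i j hij]
    · simp
    · rw [G.adj_comm, (cycleGraph _).adj_comm, key j i hij i.2, hcyc j i hij]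

/-- The restriction of a graph to a set of vertices, as a graph on all vertices. -/
def restrict (G : SimpleGraph V) (S : Set V) : SimpleGraph V where
  Adj u v := G.Adj u v ∧ u ∈ S ∧ v ∈ S
  symm := ⟨fun _ _ h => ⟨h.1.symm, h.2.2, h.2.1⟩⟩
  loopless := ⟨fun _ h => G.loopless.irrefl _ h.1⟩

/-- Two vertices that are not adjacent but connected in `S` are joined by an induced path of length
at least two in `S`. -/
theorem exists_induced_path_of_restrict {S : Set V} {p q : V} (hp : p ∈ S)
    (hpq : p ≠ q) (ha : ¬ G.Adj p q) (h : (G.restrict S).Reachable p q) :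
    ∃ (f : ℕ → V) (m : ℕ), 2 ≤ m ∧ f 0 = p ∧ f m = q ∧ (∀ i, i ≤ m → f i ∈ S) ∧
      (∀ i j, i ≤ m → j ≤ m → (G.Adj (f i) (f j) ↔ i + 1 = j ∨ j + 1 = i)) ∧
      ∀ i j, i ≤ m → j ≤ m → f i = f j → i = j := by
  obtain ⟨f, h0, h1, h2, h3⟩ := h.exists_induced_path
  have hpos := h.pos_dist_of_ne hpq
  generalize (G.restrict S).dist p q = m at *
  have hS : ∀ i, i ≤ m → f i ∈ S := by
    intro i hi
    rcases Nat.eq_zero_or_pos i with rfl | hi'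
    · rwa [h0]
    · exact ((h2 (i - 1) i (by omega) hi).2 (by omega)).2.2
  have hA : ∀ i j, i ≤ m → j ≤ m → (G.Adj (f i) (f j) ↔ i + 1 = j ∨ j + 1 = i) := by
    intro i j hi hj
    rw [← h2 i j hi hj]
    exact ⟨fun h => ⟨h, hS i hi, hS j hj⟩, fun h => h.1⟩
  refine ⟨f, m, ?_, h0, h1, hS, hA, h3⟩
  by_contra hm
  have : m = 1 := by omega
  subst this
  exact ha (h0 ▸ h1 ▸ (hA 0 1 (by omega) le_rfl).2 (by omega))

/-! ### Layers of a breadth first search -/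

/-- `u` is a neighbor of `v` in the layer (with respect to `r`) before that of `v`. -/
def IsParent (G : SimpleGraph V) (r u v : V) : Prop :=
  G.Adj u v ∧ G.dist r u + 1 = G.dist r v

/-- `u` lies on a shortest path from `r` to `v`. -/
def IsAncestor (G : SimpleGraph V) (r : V) : V → V → Prop :=
  Relation.ReflTransGen (G.IsParent r)

theorem Connected.exists_isParent (hG : G.Connected) {r v : V} (hv : v ≠ r) :
    ∃ u, G.IsParent r u v := by
  obtain ⟨W, hW⟩ := hG.exists_walk_length_eq_dist r v
  have hpos := hG.pos_dist_of_ne (Ne.symm hv)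
  have hadj : G.Adj (W.getVert (W.length - 1)) v := by
    have := W.adj_getVert_succ (i := W.length - 1) (by omega)
    rwa [show W.length - 1 + 1 = W.length by omega, W.getVert_length] at this
  refine ⟨_, hadj, ?_⟩
  have h1 : G.dist r (W.getVert (W.length - 1)) ≤ W.length - 1 :=
    (dist_le (W.take (W.length - 1))).trans (by rw [Walk.take_length]; omega)
  have := hadj.diff_dist_adj (u := r)
  omega

/-- The parity of the distance from `r` is determined by the color, and adjacent vertices have
different colors. So layers are independent sets. -/
theorem IsBipartite.dist_ne_of_adj (hb : G.IsBipartite) (hG : G.Connected) {r u v : V}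
    (h : G.Adj u v) : G.dist r u ≠ G.dist r v := by
  obtain ⟨c⟩ := hb
  let c' : G.Coloring Bool := Coloring.mk (fun v => decide (c v = 0)) (by
    intro a b hab
    have := c.valid hab
    simp only [ne_eq, decide_eq_decide]
    omega)
  intro e
  obtain ⟨W, hW⟩ := hG.exists_walk_length_eq_dist r u
  obtain ⟨W', hW'⟩ := hG.exists_walk_length_eq_dist r v
  have h1 := c'.even_length_iff_congr W
  have h2 := c'.even_length_iff_congr W'
  have h3 := c'.valid h
  rw [hW, e, ← hW', h2] at h1
  revert h1 h3
  cases c' u <;> cases c' v <;> cases c' r <;> simp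

theorem IsAncestor.dist_le {r u v : V} (h : G.IsAncestor r u v) : G.dist r u ≤ G.dist r v := by
  induction h with
  | refl => exact le_rfl
  | tail _ h ih => have := h.2; omega

/-- In the set of the vertices above the layer `k`, extended by some vertices of that layer,
everything is connected to the root. -/
theorem Connected.reachable_above (hG : G.Connected) {r : V} {k : ℕ} {S : Set V}
    (hS : ∀ u, G.dist r u < k → u ∈ S) :
    ∀ (j : ℕ) (u : V), G.dist r u = j → j ≤ k → u ∈ S → (G.restrict S).Reachable u r := by
  intro j
  induction j with
  | zero =>
    intro u hu _ _
    rw [hG.dist_eq_zero_iff] at hu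
    rw [hu]
  | succ j ih =>
    intro u hu hj huS
    obtain ⟨p, hp⟩ := hG.exists_isParent (r := r) (v := u) (by rintro rfl; simp at hu)
    have hpd := hp.2
    have hpS : p ∈ S := hS p (by omega)
    exact (Adj.reachable (G := G.restrict S) ⟨hp.1.symm, huS, hpS⟩).trans
      (ih p (by omega) (by omega) hpS)

/-- A vertex `x` is connected to its descendant `z` through vertices of larger distance. -/
theorem IsAncestor.reachable_below {r x z : V} {S : Set V} (h : G.IsAncestor r x z)
    (hS : ∀ u, G.dist r x < G.dist r u → u ∈ S) (hx : x ∈ S) :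
    (G.restrict S).Reachable x z := by
  induction h using Relation.ReflTransGen.head_induction_on with
  | refl => exact Reachable.rfl
  | @head a c h _ ih =>
    have := h.2
    have hc : c ∈ S := hS c (by omega)
    exact (Adj.reachable (G := G.restrict S) ⟨h.1, hx, hc⟩).trans
      (ih (fun u hu => hS u (by omega)) hc)

/-- In a chordal bipartite graph, the parent sets of two ancestors of a vertex in a common layer
are comparable. -/
theorem isParent_chain (hG : G.Connected) (hb : IsChordalBipartite G) {r x y z : V}
    (hx : G.IsAncestor r x z) (hy : G.IsAncestor r y z) (hxy : G.dist r x = G.dist r y) :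
    (∀ u, G.IsParent r u x → G.IsParent r u y) ∨ ∀ u, G.IsParent r u y → G.IsParent r u x := by
  by_contra hcon
  push Not at hcon
  obtain ⟨⟨p, hpx, hpy⟩, q, hqy, hqx⟩ := hcon
  have hadj_par : ∀ {u v}, G.Adj u v → G.dist r u < G.dist r v → G.IsParent r u v := by
    intro u v h hlt
    have := h.diff_dist_adj (u := r)
    exact ⟨h, by omega⟩
  have hpd := hpx.2
  have hqd := hqy.2
  have hpy' : ¬ G.Adj p y := fun h => hpy (hadj_par h (by omega))
  have hqx' : ¬ G.Adj q x := fun h => hqx (hadj_par h (by omega))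
  have hpq : p ≠ q := by rintro rfl; exact hpy hqy
  have hxy' : x ≠ y := by rintro rfl; exact hpy hpx
  -- One path joins `p` to `q` through strictly earlier layers (via `r`), the other joins `y` to `x`
  -- through strictly later ones (via `z`).
  set S : Set V := {u | u = p ∨ u = q ∨ G.dist r u < G.dist r p} with hS
  set S' : Set V := {u | u = x ∨ u = y ∨ G.dist r x < G.dist r u} with hS'
  have h1 : (G.restrict S).Reachable p q :=
    (hG.reachable_above (S := S) (fun u hu => Or.inr (Or.inr hu)) _ p rfl le_rfl (by simp [S])).trans
    (hG.reachable_above (S := S) (fun u hu => Or.inr (Or.inr hu)) _ q rfl (by omega)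
      (by simp [S])).symm
  have h2 : (G.restrict S').Reachable y x :=
    (hy.reachable_below (S := S') (fun u hu => Or.inr (Or.inr (by omega))) (by simp [S'])).trans
    (hx.reachable_below (S := S') (fun u hu => Or.inr (Or.inr hu)) (by simp [S'])).symm
  obtain ⟨f, m, hm, f0, fm, fS, fa, fi⟩ := exists_induced_path_of_restrict (by simp [S]) hpq
    (fun h => hb.1.dist_ne_of_adj hG (r := r) h (by omega)) h1
  obtain ⟨g, l, hl, g0, gl, gS, ga, gi⟩ := exists_induced_path_of_restrict (by simp [S']) hxy'.symm
    (fun h => hb.1.dist_ne_of_adj hG (r := r) h (by omega)) h2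
  have fd : ∀ i, i ≤ m → (i = 0 ∨ i = m ∨ G.dist r (f i) < G.dist r p) := by
    intro i hi
    rcases fS i hi with h | h | h
    · exact Or.inl (fi _ _ hi (by omega) (h.trans f0.symm))
    · exact Or.inr (Or.inl (fi _ _ hi le_rfl (h.trans fm.symm)))
    · exact Or.inr (Or.inr h)
  have gd : ∀ i, i ≤ l → (i = 0 ∨ i = l ∨ G.dist r x < G.dist r (g i)) := by
    intro i hi
    rcases gS i hi with h | h | h
    · exact Or.inr (Or.inl (gi _ _ hi le_rfl (h.trans gl.symm)))
    · exact Or.inl (gi _ _ hi (by omega) (h.trans g0.symm))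
    · exact Or.inr (Or.inr h)
  have fd' : ∀ i, i ≤ m → G.dist r (f i) ≤ G.dist r p := by
    intro i hi
    rcases fS i hi with h | h | h
    · rw [h]
    · rw [h]; omega
    · exact h.le
  have gd' : ∀ i, i ≤ l → G.dist r x ≤ G.dist r (g i) := by
    intro i hi
    rcases gS i hi with h | h | h
    · rw [h]
    · rw [h]; omega
    · exact h.le
  -- Both paths have length at least two, because their ends are distinct vertices of one layer, so
  -- the cycle has at least six vertices.
  have := hb.2 (m + l + 2) (by omega) (cycleGraph_embedding_of_two_paths (by omega) (by omega)
    fa ga fi gi ?_ ?_)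
  · omega
  · intro i j hi hj e
    have := fd' i hi
    have := gd' j hj
    rw [← e] at this
    omega
  · intro i j hi hj
    constructor
    · intro ha
      -- An edge changes the layer by at most one. An edge between the paths therefore joins end to
      -- end, and `p`–`y` and `q`–`x` are not edges.
      have hdiff := ha.diff_dist_adj (u := r)
      have h3 := fd' i hi
      have h4 := gd' j hj
      rcases fd i hi with rfl | rfl | h
      · rcases gd j hj with rfl | rfl | h'
        · rw [f0, g0] at ha; exact absurd ha hpy'
        · omega
        · omega
      · rcases gd j hj with rfl | rfl | h'
        · omega
        · rw [fm, gl] at ha; exact absurd ha hqx'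
        · omega
      · omega
    · rintro (⟨rfl, rfl⟩ | ⟨rfl, rfl⟩)
      · rw [fm, g0]; exact hqy.1
      · rw [f0, gl]; exact hpx.1

end SimpleGraph

/-! ### Orderings of lexicographic breadth first search -/

/-- Both clauses of the definition say that the least element of the symmetric difference belongs to
`B`. Here `m` need not be that element, which makes witnesses easy to supply. -/
theorem lbfsOrder_iff {A B : Set ℕ} :
    lbfsOrder A B ↔ ∃ m, m ∈ B ∧ m ∉ A ∧ ∀ k, k < m → k ∈ A → k ∈ B := by
  classical
  constructor
  · rintro (h | ⟨a, b, ha, hb, hab⟩)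
    · obtain ⟨m, hm, hm'⟩ := Set.exists_of_ssubset h
      exact ⟨m, hm, hm', fun k _ hk => h.1 hk⟩
    · refine ⟨b, hb.1.1, hb.1.2, fun k hk hkA => ?_⟩
      by_contra hkB
      have := ha.2 ⟨hkA, hkB⟩
      omega
  · rintro ⟨m, hmB, hmA, hm⟩
    by_cases hAB : A ⊆ B
    · exact Or.inl ⟨hAB, fun h => hmA (h hmB)⟩
    · obtain ⟨a, haA, haB⟩ := Set.not_subset.1 hAB
      have hA : ∃ a, a ∈ A \ B := ⟨a, haA, haB⟩
      have hB : ∃ b, b ∈ B \ A := ⟨m, hmB, hmA⟩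
      refine Or.inr ⟨Nat.find hA, Nat.find hB, ⟨Nat.find_spec hA, fun k hk => Nat.find_min' hA hk⟩,
        ⟨Nat.find_spec hB, fun k hk => Nat.find_min' hB hk⟩, ?_⟩
      have h1 : Nat.find hB ≤ m := Nat.find_min' hB ⟨hmB, hmA⟩
      have h2 := Nat.find_spec hA
      have h3 := Nat.find_spec hB
      by_contra hlt
      rcases eq_or_lt_of_le (not_lt.1 hlt) with h | h
      · exact h3.2 (h ▸ h2.1)
      · exact h2.2 (hm _ (by omega) h2.1)

theorem lbfsOrder_irrefl (A : Set ℕ) : ¬ lbfsOrder A A := by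
  rw [lbfsOrder_iff]
  rintro ⟨m, h, h', -⟩
  exact h' h

theorem lbfsOrder_trans {A B C : Set ℕ} (h : lbfsOrder A B) (h' : lbfsOrder B C) :
    lbfsOrder A C := by
  rw [lbfsOrder_iff] at *
  obtain ⟨m, hm, hm', hmin⟩ := h
  obtain ⟨l, hl, hl', hlmin⟩ := h'
  rcases lt_trichotomy m l with hlt | rfl | hlt
  · exact ⟨m, hlmin m hlt hm, hm', fun k hk hkA => hlmin k (by omega) (hmin k hk hkA)⟩
  · exact absurd hm hl'
  · exact ⟨l, hl, fun h => hl' (hmin l hlt h), fun k hk hkA => hlmin k hk (hmin k (by omega) hkA)⟩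

section Orderings

variable {n : ℕ} {V : Type*} {G : SimpleGraph V} {σ : Fin n ≃ V}

/-- If `u` precedes `v` and some neighbor `w` of `v` that precedes `u` is not a neighbor of `u`,
then an earlier vertex is a neighbor of `u` only. -/
theorem IsLBFSOrdering.exists_private_neighbor (hσ : IsLBFSOrdering G σ) {u v w : V}
    (huv : σ.symm u < σ.symm v) (hwu : σ.symm w < σ.symm u) (hwv : G.Adj w v)
    (hwu' : ¬ G.Adj w u) :
    ∃ w', σ.symm w' < σ.symm w ∧ G.Adj w' u ∧ ¬ G.Adj w' v := by
  by_contra hcon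
  push Not at hcon
  have h := (hσ (σ.symm u)).2
  rw [σ.apply_symm_apply] at h
  refine h ⟨v, huv.le, lbfsOrder_iff.2 ⟨(σ.symm w : ℕ) + 1, ⟨σ.symm w, hwu, by simpa using hwv, rfl⟩,
    ?_, ?_⟩⟩
  · rintro ⟨j, -, hj, hj'⟩
    have : j = σ.symm w := by ext; omega
    subst this
    exact hwu' (by simpa using hj)
  · rintro k hk ⟨j, hj, hju, rfl⟩
    refine ⟨j, hj, hcon (σ j) ?_ hju, rfl⟩
    rw [σ.symm_apply_apply, Fin.lt_def]
    omega

/-- The vertex ordering `σ` prefers vertices of smaller priority when labels are equal. -/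
def BreaksTiesBy (G : SimpleGraph V) (σ : Fin n ≃ V) (prio : V → ℕ) : Prop :=
  ∀ u v, σ.symm u < σ.symm v →
    (∀ w, σ.symm w < σ.symm u → (G.Adj w u ↔ G.Adj w v)) → prio u ≤ prio v

/-- There are LBFS orderings with any prescribed priorities for breaking ties. -/
theorem exists_isLBFSOrdering_breaksTiesBy [Fintype V] [DecidableEq V] [Nonempty V] (hn : Fintype.card V = n)
    (prio : V → ℕ) :
    ∃ σ : Fin n ≃ V, IsLBFSOrdering G σ ∧ BreaksTiesBy G σ prio := by
  -- Partial orderings are total sequences of which only an initial part matters; `Good f i` looks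
  -- at no value beyond `f i`.
  let lab : (ℕ → V) → ℕ → V → Set ℕ := fun f i v => {m | ∃ j < i, G.Adj (f j) v ∧ m = j + 1}
  let Good : (ℕ → V) → ℕ → Prop := fun f i => (∀ j < i, f j ≠ f i) ∧
    ∀ y, (∀ j < i, f j ≠ y) → ¬ lbfsOrder (lab f i (f i)) (lab f i y) ∧
      (lab f i (f i) = lab f i y → prio (f i) ≤ prio y)
  have key : ∀ k, k ≤ n → ∃ f : ℕ → V, ∀ i < k, Good f i := by
    intro k
    induction k with
    | zero =>
      exact fun _ => ⟨fun _ => Classical.arbitrary V, fun i hi => by omega⟩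
    | succ k ih =>
      intro hk
      obtain ⟨f, hf⟩ := ih (by omega)
      -- A strict order preferring larger labels and then smaller priorities; a minimal unnumbered
      -- vertex is the next choice.
      let R : V → V → Prop := fun y u => lbfsOrder (lab f k u) (lab f k y) ∨
        (lab f k u = lab f k y ∧ prio y < prio u)
      have : IsTrans V R := ⟨by
        rintro a b c (h | ⟨h, h'⟩) (g | ⟨g, g'⟩)
        · exact Or.inl (lbfsOrder_trans g h)
        · exact Or.inl (g ▸ h)
        · exact Or.inl (h ▸ g)
        · exact Or.inr ⟨g.trans h, h'.trans g'⟩⟩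
      have : Std.Irrefl R := ⟨by
        rintro a (h | ⟨-, h⟩)
        · exact lbfsOrder_irrefl _ h
        · exact lt_irrefl _ h⟩
      obtain ⟨u, hu, hmin⟩ := (Finite.wellFounded_of_trans_of_irrefl R).has_min
        {y | ∀ j < k, f j ≠ y} (by
          by_contra hne
          rw [Set.not_nonempty_iff_eq_empty] at hne
          have hsub : (Finset.univ : Finset V) ⊆ (Finset.range k).image f := by
            intro y _
            have hy : y ∉ {y | ∀ j < k, f j ≠ y} := by rw [hne]; simp
            simp only [Set.mem_ofPred_eq, not_forall, not_not] at hy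
            obtain ⟨j, hj, e⟩ := hy
            exact Finset.mem_image.2 ⟨j, Finset.mem_range.2 hj, e⟩
          have := (Finset.card_le_card hsub).trans Finset.card_image_le
          rw [Finset.card_univ, Finset.card_range] at this
          omega)
      have hlab : ∀ i, i ≤ k → lab (Function.update f k u) i = lab f i := by
        intro i hi
        funext v
        ext m
        refine exists_congr fun j => and_congr_right fun hj => ?_
        rw [Function.update_of_ne (by omega)]
      refine ⟨Function.update f k u, fun i hi => ?_⟩
      rcases Nat.lt_succ_iff_lt_or_eq.1 hi with h | rfl
      · have hg := hf i h
        have hne : ∀ j, j < k → Function.update f k u j = f j := fun j hj =>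
          Function.update_of_ne (by omega) _ _
        refine ⟨fun j hj => ?_, fun y hy => ?_⟩
        · rw [hne j (by omega), hne i h]; exact hg.1 j hj
        · rw [hlab i h.le, hne i h]
          exact hg.2 y fun j hj => by rw [← hne j (by omega)]; exact hy j hj
      · have hne : ∀ j, j < i → Function.update f i u j = f j := fun j hj =>
          Function.update_of_ne (by omega) _ _
        refine ⟨fun j hj => ?_, fun y hy => ?_⟩
        · rw [hne j hj, Function.update_self]; exact hu j hj
        · rw [hlab i le_rfl, Function.update_self]
          have hR := hmin y fun j hj => by rw [← hne j hj]; exact hy j hj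
          exact ⟨fun h => hR (Or.inl h), fun h => not_lt.1 fun h' => hR (Or.inr ⟨h, h'⟩)⟩
  obtain ⟨f, hf⟩ := key n le_rfl
  have hinj : Function.Injective fun i : Fin n => f i := by
    intro i j e
    rcases lt_trichotomy i j with h | h | h
    · exact absurd e ((hf j j.2).1 i h)
    · exact h
    · exact absurd e.symm ((hf i i.2).1 j h)
  let σ : Fin n ≃ V := Equiv.ofBijective _
    ((Fintype.bijective_iff_injective_and_card _).2 ⟨hinj, by simp [hn]⟩)
  have hσ : ∀ i, σ i = f i := fun i => rfl
  have hlab : ∀ i v, searchLabel G σ i v = lab f i v := by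
    intro i v
    ext m
    constructor
    · rintro ⟨j, hj, ha, rfl⟩
      exact ⟨j, hj, ha, rfl⟩
    · rintro ⟨j, hj, ha, rfl⟩
      exact ⟨⟨j, by omega⟩, hj, ha, rfl⟩
  have hnum : ∀ (i : Fin n) y, i ≤ σ.symm y → ∀ j < (i : ℕ), f j ≠ y := by
    rintro i y hy j hj rfl
    have : σ.symm (f j) = ⟨j, by omega⟩ := by rw [Equiv.symm_apply_eq, hσ]
    rw [this, Fin.le_def] at hy
    simp only at hy
    omega
  refine ⟨σ, fun i => ⟨by simp, ?_⟩, fun u v huv h => ?_⟩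
  · rintro ⟨y, hy, hlt⟩
    rw [hlab, hlab] at hlt
    exact ((hf i i.2).2 y (hnum i y hy)).1 hlt
  · have h1 := ((hf (σ.symm u) (σ.symm u).2).2 v (hnum _ v huv.le)).2
    rw [← hσ, σ.apply_symm_apply] at h1
    refine h1 ?_
    ext m
    refine exists_congr fun j => and_congr_right fun hj => and_congr_left fun _ => ?_
    have : f j = σ ⟨j, by omega⟩ := rfl
    rw [this]
    refine h _ ?_
    rw [σ.symm_apply_apply]
    exact hj

end Orderings

/-! ### The order inside a layer is governed by parents -/

section Root

open SimpleGraph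

variable {n : ℕ} {V : Type*} {G : SimpleGraph V} {σ : Fin n ≃ V} {r : V}

/-- An LBFS ordering is a breadth first search: it respects the distance to the first vertex. -/
theorem IsLBFSOrdering.dist_le (hσ : IsLBFSOrdering G σ) (hG : G.Connected)
    (hr : ∀ v, σ.symm r ≤ σ.symm v) :
    ∀ x y, σ.symm x < σ.symm y → G.dist r x ≤ G.dist r y := by
  suffices h : ∀ (i : ℕ) x y, (σ.symm x : ℕ) = i → σ.symm x < σ.symm y → G.dist r x ≤ G.dist r y from
    fun x y => h _ x y rfl
  intro i
  induction i using Nat.strong_induction_on with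
  | _ i ih =>
    intro x y hx hxy
    induction hk : G.dist r y using Nat.strong_induction_on generalizing y with
    | _ k ihk =>
      subst hk
      by_contra hlt
      obtain ⟨p, hpy, hpd⟩ := hG.exists_isParent (r := r) (v := y) (by
        rintro rfl
        exact absurd hxy (not_lt.2 (hr x)))
      have hpx : σ.symm p < σ.symm x := by
        rcases lt_trichotomy (σ.symm p) (σ.symm x) with h | h | h
        · exact h
        · have := σ.symm.injective h
          subst this
          omega
        · have := ihk (G.dist r p) (by omega) p h rfl
          omega
      have hax : ¬ G.Adj p x := by
        intro h
        have := h.diff_dist_adj (u := r)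
        omega
      obtain ⟨w, hwp, hwx, -⟩ := hσ.exists_private_neighbor hxy hpx hpy hax
      -- The earlier neighbor `w` of `x` is no farther from `r` than `p`, although `p` is at least
      -- two layers before `x`.
      have h1 := ih (σ.symm w) (by rw [← hx]; exact hwp.trans hpx) w p rfl hwp
      have h2 := hwx.diff_dist_adj (u := r)
      omega

/-- The first vertex in which the parent sets of `p` and `q` differ is a parent of `p`. -/
def PrecedesByParents (G : SimpleGraph V) (r : V) (σ : Fin n ≃ V) (p q : V) : Prop :=
  ∃ m, G.IsParent r m p ∧ ¬ G.IsParent r m q ∧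
    ∀ y, G.IsParent r y q → ¬ G.IsParent r y p → σ.symm m < σ.symm y

theorem PrecedesByParents.mono {p q q' : V} (h : PrecedesByParents G r σ p q)
    (hq : ∀ u, G.IsParent r u q' → G.IsParent r u q) : PrecedesByParents G r σ p q' := by
  obtain ⟨m, h1, h2, h3⟩ := h
  exact ⟨m, h1, fun h => h2 (hq m h), fun y hy => h3 y (hq y hy)⟩

theorem PrecedesByParents.of_subset {p q m : V} (hq : ∀ u, G.IsParent r u q → G.IsParent r u p)
    (hm : G.IsParent r m p) (hm' : ¬ G.IsParent r m q) : PrecedesByParents G r σ p q :=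
  ⟨m, hm, hm', fun y hy hy' => absurd (hq y hy) hy'⟩

/-- If `b` came first, missing `m` would have to be compensated by a neighbor of `b` alone that
precedes `m`. The order of the layers makes it a parent of `b`, contradicting the choice of `m`. -/
theorem PrecedesByParents.lt (hσ : IsLBFSOrdering G σ) (hG : G.Connected)
    (hr : ∀ v, σ.symm r ≤ σ.symm v) {a b : V} (hab : G.dist r a = G.dist r b)
    (h : PrecedesByParents G r σ a b) : σ.symm a < σ.symm b := by
  obtain ⟨m, ⟨hma, hmd⟩, hmb, hmin⟩ := h
  by_contra hlt
  have hba : σ.symm b < σ.symm a := by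
    refine lt_of_le_of_ne (not_lt.1 hlt) fun e => ?_
    have := σ.symm.injective e
    subst this
    exact hmb ⟨hma, hmd⟩
  have hmb' : ¬ G.Adj m b := fun h => hmb ⟨h, by omega⟩
  have hpos : σ.symm m < σ.symm b := by
    rcases lt_trichotomy (σ.symm m) (σ.symm b) with h | h | h
    · exact h
    · have := σ.symm.injective h
      subst this
      omega
    · have := hσ.dist_le hG hr _ _ h
      omega
  obtain ⟨w, hwm, hwb, hwa⟩ := hσ.exists_private_neighbor hba hpos hma hmb'
  have h1 := hσ.dist_le hG hr _ _ hwm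
  have h2 := hwb.diff_dist_adj (u := r)
  have := hmin w ⟨hwb, by omega⟩ fun h => hwa h.1
  exact absurd hwm this.not_gt

/-- Vertices of a layer with the same parents are ordered by priority. -/
theorem BreaksTiesBy.lt {prio : V → ℕ} (ht : BreaksTiesBy G σ prio) (hσ : IsLBFSOrdering G σ)
    (hG : G.Connected) (hb : G.IsBipartite)
    (hr : ∀ v, σ.symm r ≤ σ.symm v) {a b : V} (hab : G.dist r a = G.dist r b)
    (h : ∀ u, G.IsParent r u a ↔ G.IsParent r u b) (hprio : prio a < prio b) :
    σ.symm a < σ.symm b := by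
  by_contra hlt
  have hba : σ.symm b < σ.symm a := by
    refine lt_of_le_of_ne (not_lt.1 hlt) fun e => ?_
    have := σ.symm.injective e
    subst this
    exact lt_irrefl _ hprio
  have := ht b a hba fun w hw => by
    have h1 := hσ.dist_le hG hr _ _ hw
    constructor
    · intro hwb
      have h2 := hwb.diff_dist_adj (u := r)
      have h3 := hb.dist_ne_of_adj hG (r := r) hwb
      exact ((h w).2 ⟨hwb, by omega⟩).1
    · intro hwa
      have h2 := hwa.diff_dist_adj (u := r)
      have h3 := hb.dist_ne_of_adj hG (r := r) hwa
      exact ((h w).1 ⟨hwa, by omega⟩).1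
  omega

/-! ### Recursive comparison by dominating private parents -/

open Classical in
/-- The number of parents of a vertex. -/
noncomputable def parentCount [Fintype V] (G : SimpleGraph V) (r v : V) : ℕ :=
  (Finset.univ.filter fun u => G.IsParent r u v).card

/-- `x` is a parent of `a` but not of `b`, with the maximum number of parents. -/
def IsTopPrivateParent [Fintype V] (G : SimpleGraph V) (r x a b : V) : Prop :=
  G.IsParent r x a ∧ ¬ G.IsParent r x b ∧
    ∀ u, G.IsParent r u a → ¬ G.IsParent r u b → parentCount G r u ≤ parentCount G r x

/-- The outcome of comparing the vertices `a` and `b` of one layer by means of their private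
parents of maximum degree: `true` if `a` can be made to precede `b`, `false` if `b` always precedes
`a`. -/
inductive Comparison [Fintype V] (G : SimpleGraph V) (r : V) : V → V → Bool → Prop
  | win {a b : V} (h : ∀ u, G.IsParent r u b → G.IsParent r u a) : Comparison G r a b true
  | lose {a b y : V} (h : ∀ u, G.IsParent r u a → G.IsParent r u b) (hy : G.IsParent r y b)
      (hy' : ¬ G.IsParent r y a) : Comparison G r a b false
  | step {a b x y : V} {res : Bool} (hx : IsTopPrivateParent G r x a b)
      (hy : IsTopPrivateParent G r y b a) (h : Comparison G r x y res) : Comparison G r a b res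

/-- Parents of `a` have nested parent sets by `isParent_chain`, so maximum cardinality means
containing all the others. This lets one vertex represent all private parents. -/
theorem IsTopPrivateParent.isParent_of_isParent [Fintype V] (hG : G.Connected)
    (hb : IsChordalBipartite G) {x a b : V} (hx : IsTopPrivateParent G r x a b) {u : V}
    (hua : G.IsParent r u a) (hub : ¬ G.IsParent r u b) {w : V} (hw : G.IsParent r w u) :
    G.IsParent r w x := by
  classical
  have h1 := hx.1.2
  have h2 := hua.2
  rcases isParent_chain (r := r) hG hb (.single hx.1) (.single hua) (by omega) with h | h
  · have hsub : (Finset.univ.filter fun w => G.IsParent r w x) ⊆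
        Finset.univ.filter fun w => G.IsParent r w u := by
      intro w; simp only [Finset.mem_filter, Finset.mem_univ, true_and]; exact h w
    have heq := Finset.eq_of_subset_of_card_le hsub (hx.2.2 u hua hub)
    have : w ∈ Finset.univ.filter fun w => G.IsParent r w x := by
      rw [heq]; simpa using hw
    simpa using this
  · exact h w hw

/-- In a `step`, `y` precedes `x` by parents. Every other private parent `u` of `a` has its parents
among those of `x`, so `y` precedes `u` as well. No assumption on tie-breaking enters. -/
theorem Comparison.precedes_of_false [Fintype V] (hσ : IsLBFSOrdering G σ) (hG : G.Connected)
    (hb : IsChordalBipartite G) (hr : ∀ v, σ.symm r ≤ σ.symm v) {a b : V}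
    (h : Comparison G r a b false) (hab : G.dist r a = G.dist r b) :
    PrecedesByParents G r σ b a := by
  generalize hres : false = res at h
  induction h with
  | win => simp at hres
  | lose h hy hy' => exact .of_subset h hy hy'
  | @step a b x y res hx hy _ ih =>
    have h1 := hx.1.2
    have h2 := hy.1.2
    have hyx := ih (by omega) hres
    refine ⟨y, hy.1, hy.2.1, fun u hua hub => ?_⟩
    have h3 := hua.2
    exact (hyx.mono fun w hw => hx.isParent_of_isParent hG hb hua hub hw).lt hσ hG hr (by omega)

open Classical in
/-- Priorities that make the ancestors of `t` come as late as possible. -/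
noncomputable def lateAncestorPriority [Fintype V] (G : SimpleGraph V) (r t v : V) : ℕ :=
  -- Only the root has priority `0`, which forces it to be first; the summand `2` places `t` behind
  -- the vertices tied with it.
  if v = r then 0
  else (Finset.univ.filter fun b => G.IsAncestor r b t ∧ G.IsParent r v b).card +
    if v = t then 2 else 1

/-- In a `step`, `x` has to precede every private parent `u` of `b`. Strict inclusion of parent
sets, or precedence by parents, passes from `y` to `u` by domination; only a tie between `x` and `u`
needs the priorities. That `b` is an ancestor of `t` is inherited by `y`. -/
theorem Comparison.precedes_of_true [Fintype V] {t : V} (hσ : IsLBFSOrdering G σ)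
    (ht : BreaksTiesBy G σ (lateAncestorPriority G r t)) (hG : G.Connected)
    (hb : IsChordalBipartite G) (hr : ∀ v, σ.symm r ≤ σ.symm v) {a b : V}
    (h : Comparison G r a b true) (hab : G.dist r a = G.dist r b) (hbt : G.IsAncestor r b t) :
    (∀ u, G.IsParent r u b → G.IsParent r u a) ∨ PrecedesByParents G r σ a b := by
  generalize hres : true = res at h
  induction h with
  | win h => exact Or.inl h
  | lose => simp at hres
  | @step a b x y res hx hy _ ih =>
    have h1 := hx.1.2
    have h2 := hy.1.2
    refine Or.inr ⟨x, hx.1, hx.2.1, fun u hub hua => ?_⟩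
    have h3 := hub.2
    have huy : ∀ w, G.IsParent r w u → G.IsParent r w y := fun w hw =>
      hy.isParent_of_isParent hG hb hub hua hw
    rcases ih (by omega) (.head hy.1 hbt) hres with h | h
    · by_cases hw : ∃ w, G.IsParent r w x ∧ ¬ G.IsParent r w u
      · obtain ⟨w, hw, hw'⟩ := hw
        exact (PrecedesByParents.of_subset (fun v hv => h v (huy v hv)) hw hw').lt hσ hG hr
          (by omega)
      · push Not at hw
        refine ht.lt hσ hG hb.1 hr (by omega) (fun w => ⟨hw w, fun hv => h w (huy w hv)⟩) ?_
        have hur : u ≠ r := by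
          rintro rfl
          have h4 : G.dist u u = 0 := SimpleGraph.dist_self
          have h5 : G.dist u x = 0 := by omega
          rw [hG.dist_eq_zero_iff] at h5
          exact hx.2.1 (h5 ▸ hub)
        have hxt : x ≠ t := by
          rintro rfl
          have := hbt.dist_le
          omega
        have hut : u ≠ t := by
          rintro rfl
          have := hbt.dist_le
          omega
        unfold lateAncestorPriority
        rw [if_neg hur, if_neg hxt, if_neg hut]
        split_ifs with hxr
        · omega
        -- Every child `b'` of `x` above `t` is also a child of `u`: the parent sets of `b'` and `b`
        -- are nested, and `x` belongs to the first only. The child `b` of `u` makes the inclusion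
        -- strict.
        · refine Nat.add_lt_add_right (Finset.card_lt_card ?_) _
          rw [Finset.ssubset_iff_of_subset]
          · exact ⟨b, by simpa using ⟨hbt, hub⟩, by simpa [hbt] using hx.2.1⟩
          · intro b' hb'
            simp only [Finset.mem_filter, Finset.mem_univ, true_and] at hb' ⊢
            refine ⟨hb'.1, ?_⟩
            have h4 := hb'.2.2
            rcases isParent_chain (r := r) hG hb hb'.1 hbt (by omega) with h | h
            · exact absurd (h x hb'.2) hx.2.1
            · exact h u hub
    · exact (h.mono huy).lt hσ hG hr (by omega)

/-! ### From comparisons to end-vertices -/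

/-- The vertex `t` is the last vertex of an LBFS ordering that starts with `r` if it is at maximum
distance and every vertex in its layer wins the comparison with it. -/
theorem exists_isLBFSOrdering_of_comparison [Fintype V] [DecidableEq V]
    (hn : Fintype.card V = n) (hG : G.Connected) (hb : IsChordalBipartite G) {r t : V}
    (hd : ∀ v, G.dist r v ≤ G.dist r t)
    (h : ∀ v, G.dist r v = G.dist r t → Comparison G r v t true) :
    ∃ σ : Fin n ≃ V, IsLBFSOrdering G σ ∧ ∀ v, σ.symm v ≤ σ.symm t := by
  classical
  have : Nonempty V := ⟨r⟩
  obtain ⟨σ, hσ, ht⟩ := exists_isLBFSOrdering_breaksTiesBy (G := G) hn (lateAncestorPriority G r t)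
  have hpos : 0 < n := hn ▸ Fintype.card_pos_iff.2 ⟨r⟩
  have hr : ∀ v, σ.symm r ≤ σ.symm v := by
    have h0 : σ ⟨0, hpos⟩ = r := by
      by_contra hne
      have hne' : σ.symm r ≠ ⟨0, hpos⟩ := fun e => hne (by rw [← e, σ.apply_symm_apply])
      have hlt : σ.symm (σ ⟨0, hpos⟩) < σ.symm r := by
        rw [σ.symm_apply_apply, Fin.lt_def]
        exact Nat.pos_of_ne_zero fun e => hne' (Fin.ext e)
      have := ht _ _ hlt fun w hw => by
        rw [σ.symm_apply_apply, Fin.lt_def] at hw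
        simp at hw
      simp only [lateAncestorPriority, if_neg hne, if_true] at this
      split_ifs at this <;> omega
    intro v
    rw [← h0, σ.symm_apply_apply, Fin.le_def]
    exact Nat.zero_le _
  refine ⟨σ, hσ, fun v => ?_⟩
  by_cases hvt : v = t
  · rw [hvt]
  rcases lt_or_eq_of_le (hd v) with hlt | heq
  · by_contra hcon
    have := hσ.dist_le hG hr _ _ (not_le.1 hcon)
    omega
  · refine le_of_lt ?_
    rcases (h v heq).precedes_of_true hσ ht hG hb hr heq .refl with h' | h'
    · by_cases hw : ∃ w, G.IsParent r w v ∧ ¬ G.IsParent r w t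
      · obtain ⟨w, hw, hw'⟩ := hw
        exact (PrecedesByParents.of_subset h' hw hw').lt hσ hG hr heq
      · push Not at hw
        refine ht.lt hσ hG hb.1 hr heq (fun w => ⟨hw w, h' w⟩) ?_
        have htr : t ≠ r := by
          rintro rfl
          rw [SimpleGraph.dist_self, hG.dist_eq_zero_iff] at heq
          exact hvt heq.symm
        -- In the layer of `t` no vertex has children above `t`, so a tie is decided by the summands
        -- `1` and `2` alone.
        have hempty : (Finset.univ.filter fun b => G.IsAncestor r b t ∧ G.IsParent r v b).card = 0 := by
          rw [Finset.card_eq_zero, Finset.filter_eq_empty_iff]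
          rintro b - ⟨h1, h2⟩
          have := h1.dist_le
          have := h2.2
          omega
        unfold lateAncestorPriority
        rw [if_neg htr, if_neg hvt, if_pos rfl, hempty]
        split_ifs <;> omega
    · exact h'.lt hσ hG hr heq

theorem exists_root_of_isLBFSOrdering [Fintype V] (hG : G.Connected) (hb : IsChordalBipartite G)
    (hσ : IsLBFSOrdering G σ) {t : V} (ht : ∀ v, σ.symm v ≤ σ.symm t) :
    ∃ r, (∀ v, G.dist r v ≤ G.dist r t) ∧
      ∀ v, G.dist r v = G.dist r t → ¬ Comparison G r v t false := by
  have hpos : 0 < n := Fin.pos (σ.symm t)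
  have hr : ∀ v, σ.symm (σ ⟨0, hpos⟩) ≤ σ.symm v := by
    intro v
    rw [σ.symm_apply_apply, Fin.le_def]
    exact Nat.zero_le _
  refine ⟨σ ⟨0, hpos⟩, fun v => ?_, fun v hv hc => ?_⟩
  · rcases eq_or_lt_of_le (ht v) with h | h
    · rw [σ.symm.injective h]
    · exact hσ.dist_le hG hr _ _ h
  · exact absurd ((hc.precedes_of_false hσ hG hb hr hv).lt hσ hG hr hv.symm) (not_lt.2 (ht v))

end Root

/-! ### Reasoning about word RAM programs -/

namespace WordRAM

@[simp] theorem State.setReg_reg (s : State) (r x i : ℕ) :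
    (s.setReg r x).reg i = if i = r then x else s.reg i := by
  simp [State.setReg, Function.update_apply]

@[simp] theorem State.setReg_mem (s : State) (r x : ℕ) : (s.setReg r x).mem = s.mem := rfl

@[simp] theorem State.setMem_reg (s : State) (b a x : ℕ) : (s.setMem b a x).reg = s.reg := rfl

@[simp] theorem State.setMem_mem (s : State) (b a x c i : ℕ) :
    (s.setMem b a x).mem c i = if c = b ∧ i = a then x else s.mem c i := by
  by_cases hc : c = b
  · subst hc; simp [State.setMem, Function.update_apply]
  · simp [State.setMem, hc]

/-- Started in `s`, the program halts after at most `B` steps in a state that satisfies `Q`. -/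
def Runs (w : ℕ) (p : Prog) (s : State) (Q : State → Prop) (B : ℕ) : Prop :=
  ∃ s' T, Exec w p s s' T ∧ T ≤ B ∧ Q s'

variable {w : ℕ} {s : State} {Q R : State → Prop} {p q : Prog} {e : Expr} {B B' : ℕ}

theorem Runs.mono (h : Runs w p s Q B) (hQ : ∀ s', Q s' → R s') (hB : B ≤ B') :
    Runs w p s R B' := by
  obtain ⟨s', T, h1, h2, h3⟩ := h
  exact ⟨s', T, h1, h2.trans hB, hQ s' h3⟩

theorem Runs.skip (h : Q s) : Runs w .skip s Q 1 :=
  ⟨s, 1, .skip s, le_rfl, h⟩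

theorem Runs.assign {r : ℕ} (h : Q (s.setReg r (e.eval w s))) :
    Runs w (.assign r e) s Q (e.cost + 1) :=
  ⟨_, _, .assign r e s, le_rfl, h⟩

theorem Runs.store {b : ℕ} {a : Expr} (h : Q (s.setMem b (a.eval w s) (e.eval w s))) :
    Runs w (.store b a e) s Q (a.cost + e.cost + 1) :=
  ⟨_, _, .store b a e s, le_rfl, h⟩

theorem Runs.seq (hp : Runs w p s R B) (hq : ∀ s', R s' → Runs w q s' Q B') :
    Runs w (.seq p q) s Q (B + B') := by
  obtain ⟨s', T, h1, h2, h3⟩ := hp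
  obtain ⟨s'', T', h4, h5, h6⟩ := hq s' h3
  exact ⟨s'', T + T', .seq h1 h4, Nat.add_le_add h2 h5, h6⟩

theorem Runs.ite (hp : e.eval w s ≠ 0 → Runs w p s Q B) (hq : e.eval w s = 0 → Runs w q s Q B) :
    Runs w (.ite e p q) s Q (e.cost + 1 + B) := by
  by_cases h : e.eval w s = 0
  · obtain ⟨s', T, h1, h2, h3⟩ := hq h
    exact ⟨s', _, .ite_false h h1, Nat.add_le_add_left h2 _, h3⟩
  · obtain ⟨s', T, h1, h2, h3⟩ := hp h
    exact ⟨s', _, .ite_true h h1, Nat.add_le_add_left h2 _, h3⟩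

/-- Repeat the program `p` with the values `0, 1, …` of register `i` that are smaller than the
content of register `0`. -/
def forLoop (i : ℕ) (p : Prog) : Prog :=
  .seq (.assign i (.const 0))
    (.while (.op .lt (.reg i) (.reg 0)) (.seq p (.assign i (.op .add (.reg i) (.const 1)))))

/-- Each round adds `8` steps to the body, four for the test and four for the increment; the failing
test costs the final `4`. -/
theorem Runs.forLoop_aux {n i : ℕ} (hn : n < 2 ^ w) (hn' : 1 < 2 ^ w) (I : ℕ → State → Prop)
    (hI : ∀ k s, I k s → s.reg i = k ∧ s.reg 0 = n)
    (hbody : ∀ k < n, ∀ s, I k s →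
      Runs w p s (fun s' => s'.reg i = k ∧ I (k + 1) (s'.setReg i (k + 1))) B) :
    ∀ (m k : ℕ) (s : State), m + k = n → I k s →
      Runs w (.while (.op .lt (.reg i) (.reg 0)) (.seq p (.assign i (.op .add (.reg i) (.const 1)))))
        s (I n) (m * (B + 8) + 4) := by
  intro m
  induction m with
  | zero =>
    rintro k s hk h
    obtain rfl : k = n := by omega
    have := hI _ _ h
    exact ⟨s, _, .while_false (by simp [Expr.eval, BinOp.eval, this.1, this.2]),
      by simp [Expr.cost], h⟩
  | succ m ih =>
    intro k s hk h
    have h0 := hI _ _ h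
    obtain ⟨s', T, h1, h2, h3, h4⟩ := hbody k (by omega) s h
    obtain ⟨s'', T', h5, h6, h7⟩ := ih (k + 1) _ (by omega) h4
    have hass : Exec w (.assign i (.op .add (.reg i) (.const 1))) s' (s'.setReg i (k + 1)) 4 := by
      have := Exec.assign (w := w) i (.op .add (.reg i) (.const 1)) s'
      simpa [Expr.eval, BinOp.eval, Expr.cost, h3, Nat.mod_eq_of_lt (show k + 1 < 2 ^ w by omega)]
        using this
    refine ⟨s'', _, .while_true ?_ (.seq h1 hass) h5, ?_, h7⟩
    · simp [Expr.eval, BinOp.eval, h0.1, h0.2, show k < n by omega, Nat.mod_eq_of_lt hn']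
    · simp only [Expr.cost]
      rw [Nat.succ_mul]
      omega

/-- Bounds of the form `K * n ^ j` compose under nesting: the overhead `8 * n + 6` is absorbed into
`14 * n ^ (j + 1)`. -/
theorem Runs.forLoop {n i K j : ℕ} (hn : n < 2 ^ w) (hn' : 1 < 2 ^ w) (hpos : 1 ≤ n)
    (I : ℕ → State → Prop) (h0 : I 0 (s.setReg i 0))
    (hI : ∀ k s, I k s → s.reg i = k ∧ s.reg 0 = n)
    (hbody : ∀ k < n, ∀ s, I k s →
      Runs w p s (fun s' => s'.reg i = k ∧ I (k + 1) (s'.setReg i (k + 1))) (K * n ^ j)) :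
    Runs w (WordRAM.forLoop i p) s (I n) ((K + 14) * n ^ (j + 1)) := by
  refine (Runs.seq (B := 2) (R := fun s' => I 0 s') (Runs.assign (by simpa [Expr.eval] using h0))
    fun s' hs' => Runs.forLoop_aux hn hn' I hI hbody n 0 s' rfl hs').mono (fun _ h => h) ?_
  have h1 : 1 ≤ n ^ j := Nat.one_le_pow _ _ hpos
  rw [pow_succ]
  nlinarith [Nat.mul_le_mul h1 hpos]

theorem Runs.pow_mono {n K j K' j' : ℕ} (h : Runs w p s Q (K * n ^ j)) (hn : 1 ≤ n)
    (hK : K ≤ K') (hj : j ≤ j') : Runs w p s Q (K' * n ^ j') :=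
  h.mono (fun _ h => h) (Nat.mul_le_mul hK (Nat.pow_le_pow_right hn hj))

theorem Runs.to_pow {n K : ℕ} (j : ℕ) (h : Runs w p s Q K) (hn : 1 ≤ n) :
    Runs w p s Q (K * n ^ j) :=
  h.mono (fun _ h => h) (Nat.le_mul_of_pos_right _ (Nat.pow_pos hn))

theorem Runs.seq_pow {n K K' j : ℕ} (hp : Runs w p s R (K * n ^ j))
    (hq : ∀ s', R s' → Runs w q s' Q (K' * n ^ j)) :
    Runs w (.seq p q) s Q ((K + K') * n ^ j) := by
  rw [add_mul]
  exact hp.seq hq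

/-- The entry of the square matrix in bank `b` with the indices in the registers `i` and `j`. -/
def entry (b i j : ℕ) : Expr :=
  .load b (.op .add (.op .mul (.reg i) (.reg 0)) (.reg j))

theorem matrix_index_mod {n u v : ℕ} (hw : n * n + n + 2 ≤ 2 ^ w) (hu : u < n) (hv : v < n) :
    (u * n % 2 ^ w + v) % 2 ^ w = u * n + v := by
  have h : u * n ≤ n * n := Nat.mul_le_mul_right _ hu.le
  rw [Nat.mod_eq_of_lt (show u * n < 2 ^ w by omega), Nat.mod_eq_of_lt (by omega)]

theorem matrix_index_inj {n u v u' v' : ℕ} (hv : v < n) (hv' : v' < n) :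
    u * n + v = u' * n + v' ↔ u = u' ∧ v = v' := by
  constructor
  · intro h
    have h1 : (u * n + v) / n = (u' * n + v') / n := by rw [h]
    rw [mul_comm, Nat.mul_add_div (by omega), mul_comm, Nat.mul_add_div (by omega),
      Nat.div_eq_of_lt hv, Nat.div_eq_of_lt hv'] at h1
    have h2 : u = u' := by simpa using h1
    subst h2
    exact ⟨rfl, by omega⟩
  · rintro ⟨rfl, rfl⟩
    rfl

theorem eval_entry {n : ℕ} (hw : n * n + n + 2 ≤ 2 ^ w) {b i j : ℕ} {u v : Fin n}
    (h0 : s.reg 0 = n) (hi : s.reg i = u) (hj : s.reg j = v) :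
    (entry b i j).eval w s = s.mem b (u * n + v) := by
  simp only [entry, Expr.eval, BinOp.eval, h0, hi, hj, matrix_index_mod hw u.2 v.2]

end WordRAM

/-! ### Distances from the root -/

namespace WordRAM

open Classical in
/-- The indicator of a proposition. -/
noncomputable def ind (p : Prop) : ℕ := if p then 1 else 0

theorem ind_le_one (p : Prop) : ind p ≤ 1 := by unfold ind; split_ifs <;> omega

theorem ind_of_true {p : Prop} (h : p) : ind p = 1 := if_pos h

theorem ind_of_false {p : Prop} (h : ¬ p) : ind p = 0 := if_neg h

theorem ind_eq_zero {p : Prop} : ind p = 0 ↔ ¬ p := by unfold ind; split_ifs <;> simp [*]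

theorem ind_mul (p q : Prop) : ind p * ind q = ind (p ∧ q) := by
  unfold ind; split_ifs <;> simp_all

theorem ite_ind_lt_ind (p q : Prop) : (if ind p < ind q then 1 else 0) = ind (q ∧ ¬ p) := by
  by_cases hp : p <;> by_cases hq : q <;> simp [ind, hp, hq]

/-- The part of the memory that stays fixed while the root `r` is considered: `x` is the value
computed so far. -/
structure Frame {n : ℕ} (G : SimpleGraph (Fin n)) (t r : Fin n) (x : ℕ) (s : State) : Prop where
  size : s.reg 0 = n
  target : s.reg 1 = t
  value : s.reg 2 = x
  root : s.reg 3 = r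
  adj : ∀ u v : Fin n, s.mem 0 (u * n + v) = ind (G.Adj u v)
  sentinel : s.mem 2 n = 0

variable {n : ℕ} {G : SimpleGraph (Fin n)} {t r : Fin n} {x w : ℕ} {s : State}

theorem Frame.setReg (h : Frame G t r x s) {i y : ℕ} (hi : 3 < i) : Frame G t r x (s.setReg i y) := by
  obtain ⟨h1, h2, h3, h4, h5, h6⟩ := h
  refine ⟨?_, ?_, ?_, ?_, h5, h6⟩ <;> rw [State.setReg_reg, if_neg (by omega)] <;> assumption

theorem Frame.setMem (h : Frame G t r x s) {b a y : ℕ} (hb : b ≠ 0) (ha : b = 2 → a ≠ n) :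
    Frame G t r x (s.setMem b a y) := by
  obtain ⟨h1, h2, h3, h4, h5, h6⟩ := h
  refine ⟨h1, h2, h3, h4, fun u v => ?_, ?_⟩
  · rw [State.setMem_mem, if_neg (fun h => hb h.1.symm), h5]
  · rw [State.setMem_mem, if_neg (fun h => ha h.1.symm h.2.symm), h6]

/-- Improve the distance of the vertex in register `4` by means of the edge to the vertex in
register `6`. -/
def relax : Prog :=
  .ite (entry 0 6 4)
    (.ite (.op .lt (.op .add (.load 1 (.reg 6)) (.const 1)) (.load 1 (.reg 4)))
      (.store 1 (.reg 4) (.op .add (.load 1 (.reg 6)) (.const 1))) .skip) .skip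

/-- Compute the distances from the vertex in register `3` in bank `1`. -/
def distances : Prog :=
  .seq (forLoop 4 (.store 1 (.reg 4) (.reg 0)))
    (.seq (.store 1 (.reg 3) (.const 0)) (forLoop 5 (forLoop 4 (forLoop 6 relax))))

/-- Bank `1` holds upper bounds for the distances that are exact for distances up to `i`. -/
structure DistBounds (G : SimpleGraph (Fin n)) (r : Fin n) (i : ℕ) (s : State) : Prop where
  lower : ∀ v : Fin n, G.dist r v ≤ s.mem 1 v
  upper : ∀ v : Fin n, s.mem 1 v ≤ n
  tight : ∀ v : Fin n, G.dist r v ≤ i → s.mem 1 v ≤ G.dist r v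

theorem DistBounds.update {i : ℕ} (h : DistBounds G r i s) {v : Fin n} {y : ℕ}
    (hy : G.dist r v ≤ y) (hy' : y ≤ s.mem 1 v) : DistBounds G r i (s.setMem 1 v y) := by
  obtain ⟨h1, h2, h3⟩ := h
  constructor <;> intro u
  · by_cases hu : u = v
    · subst hu; simpa
    · simpa [Fin.val_inj, hu] using h1 u
  · by_cases hu : u = v
    · subst hu; simpa using hy'.trans (h2 u)
    · simpa [Fin.val_inj, hu] using h2 u
  · by_cases hu : u = v
    · subst hu; intro h; simpa using hy'.trans (h3 u h)
    · simpa [Fin.val_inj, hu] using h3 u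

/-- Entries only decrease and never fall below the true distance, so updating in place is harmless.
The bound `upper` keeps the increment from overflowing. -/
theorem runs_relax (hw : n * n + n + 2 ≤ 2 ^ w) {i : ℕ} {u v : Fin n}
    (hF : Frame G t r x s) (h4 : s.reg 4 = v) (h6 : s.reg 6 = u) (hD : DistBounds G r i s) :
    Runs w relax s (fun s' => Frame G t r x s' ∧ s'.reg = s.reg ∧ DistBounds G r i s' ∧
      (∀ v : Fin n, s'.mem 1 v ≤ s.mem 1 v) ∧
      (G.Adj u v → G.dist r u ≤ i → s'.mem 1 v ≤ G.dist r u + 1)) 30 := by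
  have hentry := eval_entry (b := 0) hw hF.size h6 h4
  have hu : (Expr.op .add (.load 1 (.reg 6)) (.const 1)).eval w s = s.mem 1 u + 1 := by
    have := hD.upper u
    have h1 : 1 % 2 ^ w = 1 := Nat.mod_eq_of_lt (by omega)
    simp only [Expr.eval, BinOp.eval, h6, h1]
    exact Nat.mod_eq_of_lt (by omega)
  have hlt : (Expr.op .lt (.op .add (.load 1 (.reg 6)) (.const 1)) (.load 1 (.reg 4))).eval w s =
      if s.mem 1 u + 1 < s.mem 1 v then 1 else 0 := by
    have h1 : 1 % 2 ^ w = 1 := Nat.mod_eq_of_lt (by omega)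
    rw [Expr.eval, hu]
    simp only [Expr.eval, BinOp.eval, h4, h1]
  refine (Runs.ite (B := 20) (fun ha => ?_) (fun ha => ?_)).mono (fun _ h => h)
    (by simp [entry, Expr.cost])
  · rw [hentry, hF.adj, ne_eq, ind_eq_zero, not_not] at ha
    refine (Runs.ite (B := 7) (fun hc => ?_) (fun hc => ?_)).mono (fun _ h => h)
      (by simp [Expr.cost])
    · rw [hlt] at hc
      have hc' : s.mem 1 u + 1 < s.mem 1 v := by by_contra h; simp [h] at hc
      refine (Runs.store ?_).mono (fun _ h => h) (by simp [Expr.cost])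
      rw [hu, Expr.eval, h4]
      have hd := ha.diff_dist_adj (u := r)
      have hl := hD.lower u
      refine ⟨hF.setMem (by omega) (by omega), rfl, hD.update (by omega) hc'.le, fun z => ?_,
        fun _ hi => ?_⟩
      · by_cases hz : z = v
        · subst hz; simpa using hc'.le
        · simp [Fin.val_inj, hz]
      · simpa using hD.tight u hi
    · rw [hlt] at hc
      have hc' : ¬ s.mem 1 u + 1 < s.mem 1 v := by intro h; simp [h] at hc
      refine (Runs.skip ⟨hF, rfl, hD, fun _ => le_rfl, fun _ hi => ?_⟩).mono (fun _ h => h)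
        (by omega)
      have := hD.tight u hi
      omega
  · rw [hentry, hF.adj, ind_eq_zero] at ha
    exact (Runs.skip ⟨hF, rfl, hD, fun _ => le_rfl, fun h => absurd h ha⟩).mono (fun _ h => h)
      (by omega)

theorem _root_.SimpleGraph.Connected.dist_lt_card {V : Type*} [Fintype V] {G : SimpleGraph V}
    (hG : G.Connected) (u v : V) : G.dist u v < Fintype.card V := by
  obtain ⟨p, hp, hp'⟩ := hG.exists_path_of_dist u v
  rw [← hp']
  exact hp.length_lt

theorem runs_distances (hw : n * n + n + 2 ≤ 2 ^ w) (hG : G.Connected) (hF : Frame G t r x s) :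
    Runs w distances s (fun s' => Frame G t r x s' ∧ ∀ v : Fin n, s'.mem 1 v = G.dist r v)
      (100 * n ^ 3) := by
  have hn : 1 ≤ n := Fin.pos r
  have hn1 : n < 2 ^ w := by omega
  have hn2 : 1 < 2 ^ w := by omega
  have hdn : ∀ v, G.dist r v < n := fun v => by simpa using hG.dist_lt_card r v
  have hinit : Runs w (forLoop 4 (.store 1 (.reg 4) (.reg 0))) s
      (fun s' => Frame G t r x s' ∧ s'.reg 4 = n ∧ ∀ v : Fin n, (v : ℕ) < n → s'.mem 1 v = n)
      (17 * n ^ 1) := by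
    refine Runs.forLoop (K := 3) (j := 0) hn1 hn2 hn (fun k s' => Frame G t r x s' ∧ s'.reg 4 = k ∧
      ∀ v : Fin n, (v : ℕ) < k → s'.mem 1 v = n) ⟨hF.setReg (by omega), by simp, by simp⟩
      (fun k s' h => ⟨h.2.1, h.1.size⟩) fun k hk s' ⟨h1, h2, h3⟩ => ?_
    refine (Runs.store ⟨?_, (h1.setMem (by omega) (by omega)).setReg (by omega), by simp,
      fun v hv => ?_⟩).mono (fun _ h => h) (by simp [Expr.cost])
    · simpa using h2
    · by_cases hvk : (v : ℕ) = k
      · simp [Expr.eval, h2, h1.size, hvk]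
      · simpa [Expr.eval, h2, hvk] using h3 v (by omega)
  have hinit2 : ∀ s', (Frame G t r x s' ∧ s'.reg 4 = n ∧ ∀ v : Fin n, (v : ℕ) < n → s'.mem 1 v = n) →
      Runs w (.store 1 (.reg 3) (.const 0)) s'
        (fun s' => Frame G t r x s' ∧ DistBounds G r 0 s') 3 := by
    rintro s' ⟨h1, -, h3⟩
    refine Runs.store ⟨h1.setMem (by omega) (by omega), ?_⟩
    have : DistBounds G r 0 (s'.setMem 1 r 0) := by
      constructor <;> intro v
      · by_cases hv : v = r
        · simp [hv]
        -- The initial value `n` serves as infinity, since distances in a connected graph are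
        -- smaller than `n`.
        · simpa [Fin.val_inj, hv, h3] using (hdn v).le
      · by_cases hv : v = r
        · simp [hv]
        · simp [Fin.val_inj, hv, h3]
      · intro h0
        have : v = r := by
          rw [Nat.le_zero, hG.dist_eq_zero_iff] at h0
          exact h0.symm
        simp [this]
    simpa [Expr.eval, h1.root] using this
  have hmain : ∀ s', (Frame G t r x s' ∧ DistBounds G r 0 s') →
      Runs w (forLoop 5 (forLoop 4 (forLoop 6 relax))) s'
        (fun s' => Frame G t r x s' ∧ s'.reg 5 = n ∧ DistBounds G r n s') (72 * n ^ 3) := by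
    rintro s' ⟨hF', hD'⟩
    refine Runs.forLoop (K := 58) (j := 2) hn1 hn2 hn
      (fun i s' => Frame G t r x s' ∧ s'.reg 5 = i ∧ DistBounds G r i s')
      ⟨hF'.setReg (by omega), by simp, hD'.1, hD'.2, hD'.3⟩ (fun i s' h => ⟨h.2.1, h.1.size⟩)
      fun i _ s' ⟨h1, h2, h3⟩ => ?_
    refine (Runs.forLoop (K := 44) (j := 1) hn1 hn2 hn (fun k s' => Frame G t r x s' ∧ s'.reg 4 = k ∧
      s'.reg 5 = i ∧ DistBounds G r i s' ∧
      ∀ v : Fin n, (v : ℕ) < k → G.dist r v ≤ i + 1 → s'.mem 1 v ≤ G.dist r v)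
      ⟨h1.setReg (by omega), by simp, by simpa using h2, ⟨h3.1, h3.2, h3.3⟩, by simp⟩
      (fun k s' h => ⟨h.2.1, h.1.size⟩) fun k hk s' ⟨h1, h2, h3, h4, h5⟩ => ?_).mono
      (fun s' ⟨h1, h2, h3, h4, h5⟩ => ⟨h3, h1.setReg (by omega), by simp, h4.1, h4.2,
        fun v => h5 v v.2⟩) le_rfl
    refine (Runs.forLoop (K := 30) (j := 0) hn1 hn2 hn (fun l s' => Frame G t r x s' ∧ s'.reg 6 = l ∧
      s'.reg 4 = k ∧ s'.reg 5 = i ∧ DistBounds G r i s' ∧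
      (∀ v : Fin n, (v : ℕ) < k → G.dist r v ≤ i + 1 → s'.mem 1 v ≤ G.dist r v) ∧
      ∀ u v : Fin n, (u : ℕ) < l → (v : ℕ) = k → G.Adj u v → G.dist r u ≤ i →
        s'.mem 1 v ≤ G.dist r u + 1)
      ⟨h1.setReg (by omega), by simp, by simpa using h2, by simpa using h3, ⟨h4.1, h4.2, h4.3⟩,
        h5, by simp⟩
      (fun l s' h => ⟨h.2.1, h.1.size⟩) fun l hl s' ⟨h1, h2, h3, h4, h5, h6, h7⟩ => ?_).mono
      (fun s' ⟨h1, h2, h3, h4, h5, h6, h7⟩ => ⟨h3, h1.setReg (by omega), by simp, by simpa using h4,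
        ⟨h5.1, h5.2, h5.3⟩, fun v hv hvi => ?_⟩) le_rfl
    · refine ((runs_relax hw (u := ⟨l, hl⟩) (v := ⟨k, hk⟩) h1 h3 h2 h5).mono
        (fun s'' ⟨g1, g2, g3, g4, g5⟩ => ⟨by rw [g2, h2], g1.setReg (by omega), by simp,
          by simp [g2, h3], by simp [g2, h4], ⟨g3.1, g3.2, g3.3⟩,
          fun v hv hvi => (g4 v).trans (h6 v hv hvi), fun u v hu hv ha hui => ?_⟩) le_rfl).to_pow 0 hn
      rcases Nat.lt_succ_iff_lt_or_eq.1 hu with hu | hu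
      · exact (g4 v).trans (h7 u v hu hv ha hui)
      · have e1 : u = ⟨l, hl⟩ := Fin.ext hu
        have e2 : v = ⟨k, hk⟩ := Fin.ext hv
        subst e1 e2
        exact g5 ha hui
    · rcases Nat.lt_succ_iff_lt_or_eq.1 hv with hv | hv
      · exact h6 v hv hvi
      · rcases Nat.lt_succ_iff_lt_or_eq.1 (Nat.lt_succ_of_le hvi) with hvi | hvi
        · exact h5.tight v (by omega)
        -- A vertex in layer `i + 1` got its exact distance when the edge from one of its parents
        -- was relaxed.
        · obtain ⟨u, hu, hud⟩ := hG.exists_isParent (r := r) (v := v) (by rintro rfl; simp at hvi)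
          have := h7 u v u.2 hv hu (by omega)
          simpa using this.trans (by omega)
  refine ((hinit.pow_mono (K' := 17) (j' := 3) hn le_rfl (by omega)).seq_pow fun s' h =>
    ((hinit2 s' h).to_pow 3 hn).seq_pow fun s' h => hmain s' h).mono
    (fun s' ⟨h1, _, h3⟩ => ⟨h1, fun v => le_antisymm (h3.tight v (hdn v).le) (h3.lower v)⟩)
    (Nat.mul_le_mul_right _ (by omega))

end WordRAM

/-! ### Parents and their numbers -/

namespace WordRAM

variable {n : ℕ} {G : SimpleGraph (Fin n)} {t r : Fin n} {x w : ℕ} {s : State}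

/-- Compute the matrix of the parent relation in bank `3` and the successors of the numbers of
parents in bank `2`. -/
def parents : Prog :=
  -- Counting starts at `1`, so every stored count exceeds the `0` in cell `n`, which stands for "no
  -- vertex".
  forLoop 4 (.seq (.assign 7 (.const 1))
    (.seq (forLoop 6 (.seq
      (.store 3 (.op .add (.op .mul (.reg 6) (.reg 0)) (.reg 4)) (.op .mul (entry 0 6 4)
        (.op .eq (.op .add (.load 1 (.reg 6)) (.const 1)) (.load 1 (.reg 4)))))
      (.assign 7 (.op .add (.reg 7) (entry 3 6 4)))))
    (.store 2 (.reg 4) (.reg 7))))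

/-- The tables computed from the graph for the root `r` are in the memory. -/
structure Tables (G : SimpleGraph (Fin n)) (t r : Fin n) (x : ℕ) (s : State) : Prop
    extends Frame G t r x s where
  dist : ∀ v : Fin n, s.mem 1 v = G.dist r v
  parent : ∀ u v : Fin n, s.mem 3 (u * n + v) = ind (G.IsParent r u v)
  count : ∀ v : Fin n, s.mem 2 v = parentCount G r v + 1

theorem Tables.setReg (h : Tables G t r x s) {i y : ℕ} (hi : 3 < i) :
    Tables G t r x (s.setReg i y) :=
  ⟨h.toFrame.setReg hi, h.dist, h.parent, h.count⟩

/-- The number of parents of `v` that are smaller than `l`. -/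
noncomputable def parentCountBelow (G : SimpleGraph (Fin n)) (r v : Fin n) (l : ℕ) : ℕ :=
  ∑ u ∈ Finset.range l, ind (∃ h : u < n, G.IsParent r ⟨u, h⟩ v)

theorem parentCountBelow_succ (v : Fin n) {l : ℕ} (hl : l < n) :
    parentCountBelow G r v (l + 1) = parentCountBelow G r v l + ind (G.IsParent r ⟨l, hl⟩ v) := by
  rw [parentCountBelow, Finset.sum_range_succ, parentCountBelow]
  simp [hl]

theorem parentCountBelow_le (v : Fin n) (l : ℕ) : parentCountBelow G r v l ≤ l := by
  refine (Finset.sum_le_card_nsmul _ _ 1 fun _ _ => ind_le_one _).trans ?_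
  simp

theorem parentCountBelow_self (v : Fin n) : parentCountBelow G r v n = parentCount G r v := by
  rw [parentCountBelow, Finset.sum_range, parentCount, Finset.card_filter]
  refine Finset.sum_congr rfl fun u _ => ?_
  have h : (∃ h : (u : ℕ) < n, G.IsParent r ⟨u, h⟩ v) ↔ G.IsParent r u v :=
    ⟨fun ⟨_, h⟩ => h, fun h => ⟨u.2, h⟩⟩
  rw [propext h]
  rfl

theorem runs_parents (hw : n * n + n + 2 ≤ 2 ^ w) (hF : Frame G t r x s)
    (hD : ∀ v : Fin n, s.mem 1 v = G.dist r v) (hG : G.Connected) :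
    Runs w parents s (Tables G t r x) (100 * n ^ 2) := by
  have hn : 1 ≤ n := Fin.pos r
  have hn1 : n < 2 ^ w := by omega
  have hn2 : 1 < 2 ^ w := by omega
  have hone : 1 % 2 ^ w = 1 := Nat.mod_eq_of_lt hn2
  have hdn : ∀ v, G.dist r v < n := fun v => by simpa using hG.dist_lt_card r v
  refine ((Runs.forLoop (K := 60) (j := 1) hn1 hn2 hn (fun k s' => Frame G t r x s' ∧ s'.reg 4 = k ∧
    (∀ v : Fin n, s'.mem 1 v = G.dist r v) ∧
    (∀ u v : Fin n, (v : ℕ) < k → s'.mem 3 (u * n + v) = ind (G.IsParent r u v)) ∧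
    (∀ v : Fin n, (v : ℕ) < k → s'.mem 2 v = parentCount G r v + 1))
    ⟨hF.setReg (by omega), by simp, hD, by simp, by simp⟩ (fun k s' h => ⟨h.2.1, h.1.size⟩)
    fun k hk s' ⟨h1, h2, h3, h4, h5⟩ => ?_).mono
    (fun s' ⟨h1, h2, h3, h4, h5⟩ => ⟨h1, h3, fun u v => h4 u v v.2, fun v => h5 v v.2⟩)
    (Nat.mul_le_mul_right _ (by omega)))
  have hloop : ∀ s', (Frame G t r x s' ∧ s'.reg 4 = k ∧ (∀ v : Fin n, s'.mem 1 v = G.dist r v) ∧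
      (∀ u v : Fin n, (v : ℕ) < k → s'.mem 3 (u * n + v) = ind (G.IsParent r u v)) ∧
      (∀ v : Fin n, (v : ℕ) < k → s'.mem 2 v = parentCount G r v + 1) ∧ s'.reg 7 = 1) →
      Runs w (forLoop 6 (.seq
        (.store 3 (.op .add (.op .mul (.reg 6) (.reg 0)) (.reg 4)) (.op .mul (entry 0 6 4)
          (.op .eq (.op .add (.load 1 (.reg 6)) (.const 1)) (.load 1 (.reg 4)))))
        (.assign 7 (.op .add (.reg 7) (entry 3 6 4))))) s' (fun s' => Frame G t r x s' ∧
        s'.reg 6 = n ∧ s'.reg 4 = k ∧ (∀ v : Fin n, s'.mem 1 v = G.dist r v) ∧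
        (∀ u v : Fin n, (v : ℕ) < k ∨ (v : ℕ) = k ∧ (u : ℕ) < n →
          s'.mem 3 (u * n + v) = ind (G.IsParent r u v)) ∧
        (∀ v : Fin n, (v : ℕ) < k → s'.mem 2 v = parentCount G r v + 1) ∧
        s'.reg 7 = parentCountBelow G r ⟨k, hk⟩ n + 1) (44 * n ^ 1) := by
    rintro s' ⟨h1, h2, h3, h4, h5, h6⟩
    refine Runs.forLoop (K := 30) (j := 0) hn1 hn2 hn (fun l s' => Frame G t r x s' ∧
        s'.reg 6 = l ∧ s'.reg 4 = k ∧ (∀ v : Fin n, s'.mem 1 v = G.dist r v) ∧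
        (∀ u v : Fin n, (v : ℕ) < k ∨ (v : ℕ) = k ∧ (u : ℕ) < l →
          s'.mem 3 (u * n + v) = ind (G.IsParent r u v)) ∧
        (∀ v : Fin n, (v : ℕ) < k → s'.mem 2 v = parentCount G r v + 1) ∧
        s'.reg 7 = parentCountBelow G r ⟨k, hk⟩ l + 1)
      ⟨h1.setReg (by omega), by simp, by simpa using h2, h3, by simpa using h4, h5,
        by simpa [parentCountBelow] using h6⟩
      (fun l s' h => ⟨h.2.1, h.1.size⟩) fun l hl s' ⟨h1, h2, h3, h4, h5, h6, h7⟩ => ?_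
    have haddr : (Expr.op .add (.op .mul (.reg 6) (.reg 0)) (.reg 4)).eval w s' = l * n + k := by
      simp only [Expr.eval, BinOp.eval, h2, h3, h1.size, matrix_index_mod hw hl hk]
    have hval : (Expr.op .mul (entry 0 6 4) (.op .eq (.op .add (.load 1 (.reg 6)) (.const 1))
        (.load 1 (.reg 4)))).eval w s' = ind (G.IsParent r ⟨l, hl⟩ ⟨k, hk⟩) := by
      have e1 := eval_entry (b := 0) (u := ⟨l, hl⟩) (v := ⟨k, hk⟩) hw h1.size h2 h3
      have e2 := h4 ⟨l, hl⟩
      have e3 := h4 ⟨k, hk⟩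
      have e4 := hdn ⟨l, hl⟩
      simp only at e2 e3
      rw [Expr.eval, e1, h1.adj]
      simp only [Expr.eval, BinOp.eval, h2, h3, hone, e2, e3]
      rw [Nat.mod_eq_of_lt (show G.dist r ⟨l, hl⟩ + 1 < 2 ^ w by omega)]
      have e5 : (if G.dist r ⟨l, hl⟩ + 1 = G.dist r ⟨k, hk⟩ then 1 else 0) =
        ind (G.dist r ⟨l, hl⟩ + 1 = G.dist r ⟨k, hk⟩) := by unfold ind; congr
      rw [e5, ind_mul]
      exact Nat.mod_eq_of_lt ((ind_le_one _).trans_lt hn2)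
    refine (((Runs.store (Q := fun s'' => s'' = s'.setMem 3 (l * n + k)
      (ind (G.IsParent r ⟨l, hl⟩ ⟨k, hk⟩))) (by rw [haddr, hval])).seq
      (Q := fun s'' => s'' = (s'.setMem 3 (l * n + k)
        (ind (G.IsParent r ⟨l, hl⟩ ⟨k, hk⟩))).setReg 7 (parentCountBelow G r ⟨k, hk⟩ (l + 1) + 1))
      fun s'' hs'' => Runs.assign ?_).mono
      (fun s'' hs'' => ?_) (by simp [entry, Expr.cost])).to_pow 0 hn
    · subst hs''
      congr 1
      have e1 := eval_entry (s := s'.setMem 3 (l * n + k) (ind (G.IsParent r ⟨l, hl⟩ ⟨k, hk⟩)))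
        (b := 3) (u := ⟨l, hl⟩) (v := ⟨k, hk⟩) hw h1.size h2 h3
      rw [Expr.eval, e1]
      simp only [Expr.eval, BinOp.eval, State.setMem_reg, State.setMem_mem, and_self, if_true, h7]
      rw [parentCountBelow_succ _ hl]
      have := parentCountBelow_le (G := G) (r := r) ⟨k, hk⟩ l
      have := ind_le_one (G.IsParent r ⟨l, hl⟩ ⟨k, hk⟩)
      rw [Nat.mod_eq_of_lt (by omega)]
      omega
    · subst hs''
      refine ⟨by simpa using h2, ((h1.setMem (by omega) (by omega)).setReg (by omega)).setReg
        (by omega), by simp, by simpa using h3, by simpa using h4, fun u v huv => ?_,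
        by simpa using h6, by simp⟩
      simp only [State.setReg_mem, State.setMem_mem, true_and, matrix_index_inj v.2 hk]
      split_ifs with he
      · have e1 : u = ⟨l, hl⟩ := Fin.ext he.1
        have e2 : v = ⟨k, hk⟩ := Fin.ext he.2
        rw [e1, e2]
      · exact h5 u v (by omega)
  refine (((Runs.assign (Q := fun s'' => s'' = s'.setReg 7 1)
    (by simp [Expr.eval, hone])).to_pow 1 hn).seq_pow (K' := 44 + 3)
    fun s'' hs'' => (hloop s'' ?_).seq_pow fun s'' ⟨g1, _, g3, g4, g5, g6, g7⟩ =>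
    ((Runs.store ?_).to_pow 1 hn)).mono (fun _ h => h)
    (Nat.mul_le_mul_right _ (by simp [Expr.cost]))
  · subst hs''
    exact ⟨h1.setReg (by omega), by simpa using h2, h3, h4, h5, by simp⟩
  · simp only [Expr.eval, g3, g7, parentCountBelow_self]
    refine ⟨g3, (g1.setMem (by omega) (by omega)).setReg (by omega), by simp,
      by simpa using g4, fun u v huv => ?_, fun v hv => ?_⟩
    · simpa using g5 u v (by omega)
    · simp only [State.setReg_mem, State.setMem_mem, true_and]
      split_ifs with he
      · have e2 : v = ⟨k, hk⟩ := Fin.ext he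
        rw [e2]
      · exact g6 v (by omega)

/-! ### Comparisons -/

/-- Compute a private parent, with the maximum number of parents, of the vertex in register `a`
with respect to the vertex in register `b` in register `i`; the result is the number of vertices if
there is none. -/
def scan (i a b : ℕ) : Prog :=
  .seq (.assign i (.reg 0)) (forLoop 6
    (.ite (.op .lt (entry 3 6 b) (entry 3 6 a))
      (.ite (.op .lt (.load 2 (.reg i)) (.load 2 (.reg 6))) (.assign i (.reg 6)) .skip) .skip))

theorem runs_scan (hw : n * n + n + 2 ≤ 2 ^ w) (hT : Tables G t r x s) {i a b : ℕ} {va vb : Fin n}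
    (ha : s.reg a = va) (hb : s.reg b = vb) (hi : 6 < i) (ha' : 6 < a) (hb' : 6 < b) (hai : a ≠ i)
    (hbi : b ≠ i) :
    Runs w (scan i a b) s (fun s' => Tables G t r x s' ∧ (∀ c, c ≠ i → c ≠ 6 → s'.reg c = s.reg c) ∧
      ((s'.reg i = n ∧ ∀ u, G.IsParent r u va → G.IsParent r u vb) ∨
        ∃ y : Fin n, s'.reg i = y ∧ IsTopPrivateParent G r y va vb)) (60 * n ^ 1) := by
  have hn : 1 ≤ n := Fin.pos r
  have hn1 : n < 2 ^ w := by omega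
  have hn2 : 1 < 2 ^ w := by omega
  have hone : 1 % 2 ^ w = 1 := Nat.mod_eq_of_lt hn2
  have hloop : ∀ s', Tables G t r x s' ∧ (∀ c, c ≠ i → s'.reg c = s.reg c) ∧ s'.reg i = n →
      Runs w (forLoop 6 (.ite (.op .lt (entry 3 6 b) (entry 3 6 a))
      (.ite (.op .lt (.load 2 (.reg i)) (.load 2 (.reg 6))) (.assign i (.reg 6)) .skip) .skip)) s'
      (fun s' => Tables G t r x s' ∧ s'.reg 6 = n ∧ (∀ c, c ≠ i → c ≠ 6 → s'.reg c = s.reg c) ∧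
      ((s'.reg i = n ∧ ∀ u : Fin n, (u : ℕ) < n → G.IsParent r u va → G.IsParent r u vb) ∨
        ∃ y : Fin n, s'.reg i = y ∧ G.IsParent r y va ∧ ¬ G.IsParent r y vb ∧
          ∀ u : Fin n, (u : ℕ) < n → G.IsParent r u va → ¬ G.IsParent r u vb →
          parentCount G r u ≤ parentCount G r y)) (54 * n ^ 1) := by
    rintro s' ⟨h1, h2, h3⟩
    refine Runs.forLoop (K := 40) (j := 0) hn1 hn2 hn (fun l s' => Tables G t r x s' ∧ s'.reg 6 = l ∧
      (∀ c, c ≠ i → c ≠ 6 → s'.reg c = s.reg c) ∧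
      ((s'.reg i = n ∧ ∀ u : Fin n, (u : ℕ) < l → G.IsParent r u va → G.IsParent r u vb) ∨
        ∃ y : Fin n, s'.reg i = y ∧ G.IsParent r y va ∧ ¬ G.IsParent r y vb ∧
          ∀ u : Fin n, (u : ℕ) < l → G.IsParent r u va → ¬ G.IsParent r u vb →
          parentCount G r u ≤ parentCount G r y))
      ⟨h1.setReg (by omega), by simp, fun c hc hc' => ?_, Or.inl ⟨?_, by simp⟩⟩
      (fun l s' h => ⟨h.2.1, h.1.size⟩) fun l hl s' ⟨h1, h2, h3, h4⟩ => ?_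
    · rw [State.setReg_reg, if_neg hc', h2 c hc]
    · rw [State.setReg_reg, if_neg (by omega), h3]
    have e1 := eval_entry (b := 3) (u := ⟨l, hl⟩) (v := va) hw h1.size h2
      ((h3 a hai (by omega)).trans ha)
    have e2 := eval_entry (b := 3) (u := ⟨l, hl⟩) (v := vb) hw h1.size h2
      ((h3 b hbi (by omega)).trans hb)
    have htest : (Expr.op .lt (entry 3 6 b) (entry 3 6 a)).eval w s' =
        ind (G.IsParent r ⟨l, hl⟩ va ∧ ¬ G.IsParent r ⟨l, hl⟩ vb) := by
      rw [Expr.eval, e1, e2, h1.parent, h1.parent, BinOp.eval, hone]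
      exact ite_ind_lt_ind _ _
    have hkeep : ∀ y, Tables G t r x (s'.setReg 6 y) ∧
        ∀ c, c ≠ i → c ≠ 6 → (s'.setReg 6 y).reg c = s.reg c := by
      refine fun y => ⟨h1.setReg (by omega), fun c hc hc' => ?_⟩
      rw [State.setReg_reg, if_neg hc', h3 c hc hc']
    have hi6 : i ≠ 6 := by omega
    refine ((Runs.ite (B := 10) (fun hc => ?_) (fun hc => ?_)).mono (fun _ h => h)
      (by simp [entry, Expr.cost])).to_pow 0 hn
    · have hpriv : G.IsParent r ⟨l, hl⟩ va ∧ ¬ G.IsParent r ⟨l, hl⟩ vb := by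
        by_contra h; rw [htest, ind_of_false h] at hc; exact hc rfl
      have htest2 : (Expr.op .lt (.load 2 (.reg i)) (.load 2 (.reg 6))).eval w s' =
          if s'.mem 2 (s'.reg i) < parentCount G r ⟨l, hl⟩ + 1 then 1 else 0 := by
        have := h1.count ⟨l, hl⟩
        simp only at this
        simp only [Expr.eval, BinOp.eval, hone, h2, this]
      refine (Runs.ite (B := 2) (fun hc => ?_) (fun hc => ?_)).mono (fun _ h => h)
        (by simp [Expr.cost])
      · have hlt : s'.mem 2 (s'.reg i) < parentCount G r ⟨l, hl⟩ + 1 := by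
          by_contra h; rw [htest2, if_neg h] at hc; exact hc rfl
        refine Runs.assign ⟨by simp [hi6.symm, h2], (h1.setReg (by omega)).setReg (by omega),
          by simp, fun c hc hc' => ?_, Or.inr ⟨⟨l, hl⟩, by simp [hi6, Expr.eval, h2], hpriv.1,
          hpriv.2, fun u hu hua hub => ?_⟩⟩
        · rw [State.setReg_reg, if_neg hc', State.setReg_reg, if_neg hc, h3 c hc hc']
        · rcases Nat.lt_succ_iff_lt_or_eq.1 hu with hu | hu
          · rcases h4 with h4 | ⟨y, hy, -, -, hmax⟩
            · exact absurd (h4.2 u hu hua) hub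
            · have := hmax u hu hua hub
              rw [hy, h1.count] at hlt
              omega
          · have : u = ⟨l, hl⟩ := Fin.ext hu
            rw [this]
      · have hlt : ¬ s'.mem 2 (s'.reg i) < parentCount G r ⟨l, hl⟩ + 1 := by
          intro h; rw [htest2, if_pos h] at hc; exact one_ne_zero hc
        refine (Runs.skip ⟨h2, (hkeep _).1, by simp, (hkeep _).2, ?_⟩).mono (fun _ h => h) (by omega)
        rcases h4 with h4 | ⟨y, hy, hya, hyb, hmax⟩
        -- With no candidate yet, the lookup hits the sentinel `0`, so the first private parent is
        -- always accepted.
        · rw [h4.1, h1.sentinel] at hlt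
          omega
        · refine Or.inr ⟨y, by simp [hi6, hy], hya, hyb, fun u hu hua hub => ?_⟩
          rcases Nat.lt_succ_iff_lt_or_eq.1 hu with hu | hu
          · exact hmax u hu hua hub
          · have : u = ⟨l, hl⟩ := Fin.ext hu
            rw [hy, h1.count] at hlt
            rw [this]
            omega
    · have hpriv : ¬ (G.IsParent r ⟨l, hl⟩ va ∧ ¬ G.IsParent r ⟨l, hl⟩ vb) := by
        intro h; rw [htest, ind_of_true h] at hc; exact one_ne_zero hc
      refine (Runs.skip ⟨h2, (hkeep _).1, by simp, (hkeep _).2, ?_⟩).mono (fun _ h => h) (by omega)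
      have hnew : ∀ u : Fin n, (u : ℕ) = l → G.IsParent r u va → ¬ G.IsParent r u vb → False := by
        intro u hu hua hub
        have : u = ⟨l, hl⟩ := Fin.ext hu
        subst this
        exact hpriv ⟨hua, hub⟩
      rcases h4 with h4 | ⟨y, hy, hya, hyb, hmax⟩
      · refine Or.inl ⟨by simp [hi6, h4.1], fun u hu hua => ?_⟩
        rcases Nat.lt_succ_iff_lt_or_eq.1 hu with hu | hu
        · exact h4.2 u hu hua
        · by_contra hub
          exact hnew u hu hua hub
      · refine Or.inr ⟨y, by simp [hi6, hy], hya, hyb, fun u hu hua hub => ?_⟩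
        rcases Nat.lt_succ_iff_lt_or_eq.1 hu with hu | hu
        · exact hmax u hu hua hub
        · exact (hnew u hu hua hub).elim
  refine ((Runs.assign (Q := fun s' => s' = s.setReg i n) (by simp [Expr.eval, hT.size])).to_pow 1
    hn |>.seq_pow fun s' hs' => hloop s' ?_).mono (fun s' ⟨h1, _, h3, h4⟩ => ⟨h1, h3, ?_⟩)
    (Nat.mul_le_mul_right _ (by simp [Expr.cost]))
  · subst hs'
    exact ⟨hT.setReg (by omega), fun c hc => by simp [hc], by simp⟩
  · rcases h4 with ⟨h4, h5⟩ | ⟨y, hy, h5, h6, h7⟩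
    · exact Or.inl ⟨h4, fun u => h5 u u.2⟩
    · exact Or.inr ⟨y, hy, h5, h6, fun u => h7 u u.2⟩

end WordRAM

namespace WordRAM

variable {n : ℕ} {G : SimpleGraph (Fin n)} {t r : Fin n} {x w : ℕ} {s : State}

/-- One step of the comparison of the vertices in the registers `9` and `10`. Register `8` is
cleared if the comparison is lost. -/
def compareStep : Prog :=
  .seq (scan 11 9 10) (.seq (scan 12 10 9)
    -- This test must come first: if neither vertex has a private parent, the comparison is won.
    (.ite (.op .eq (.reg 12) (.reg 0)) .skip
      (.ite (.op .eq (.reg 11) (.reg 0)) (.assign 8 (.const 0))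
        (.seq (.assign 9 (.reg 11)) (.assign 10 (.reg 12))))))

/-- Compare the vertex in register `4` with the vertex in register `1`. -/
def compareVertices : Prog :=
  .seq (.seq (.assign 9 (.reg 4)) (.assign 10 (.reg 1))) (forLoop 5 compareStep)

/-- The state of the comparison of `v` with `t` after `i` steps: it is undecided and has been reduced
to a comparison in a lower layer, or it is won, or it is lost. -/
def CompareState (G : SimpleGraph (Fin n)) (t r v : Fin n) (ok i : ℕ) (s : State) : Prop :=
  ∃ a b : Fin n, s.reg 9 = a ∧ s.reg 10 = b ∧
    ((s.reg 8 = ok ∧ G.dist r a = G.dist r b ∧ G.dist r a + i = G.dist r t ∧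
        ∀ res, Comparison G r a b res → Comparison G r v t res) ∨
      (s.reg 8 = ok ∧ (∀ u, G.IsParent r u b → G.IsParent r u a) ∧ Comparison G r v t true) ∨
      (s.reg 8 = 0 ∧ Comparison G r v t false))

theorem CompareState.congr {v : Fin n} {ok i : ℕ} {s' : State} (h : CompareState G t r v ok i s)
    (h8 : s'.reg 8 = s.reg 8) (h9 : s'.reg 9 = s.reg 9) (h10 : s'.reg 10 = s.reg 10) :
    CompareState G t r v ok i s' := by
  unfold CompareState
  rw [h8, h9, h10]
  exact h

/-- Verdicts persist under superfluous steps. After a win the second vertex has no private parent,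
so nothing changes; after a loss register `8` stays `0`, wherever the compared pair moves. -/
theorem runs_compareStep (hw : n * n + n + 2 ≤ 2 ^ w) (hT : Tables G t r x s) {v : Fin n}
    {ok i : ℕ} (hc : CompareState G t r v ok i s) :
    Runs w compareStep s (fun s' => Tables G t r x s' ∧ s'.reg 4 = s.reg 4 ∧ s'.reg 5 = s.reg 5 ∧
      CompareState G t r v ok (i + 1) s') (140 * n ^ 1) := by
  have hn : 1 ≤ n := Fin.pos r
  have hn2 : 1 < 2 ^ w := by omega
  have hone : 1 % 2 ^ w = 1 := Nat.mod_eq_of_lt hn2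
  obtain ⟨a, b, ha, hb, hc⟩ := hc
  refine ((runs_scan (i := 11) (a := 9) (b := 10) hw hT ha hb (by omega) (by omega) (by omega)
    (by omega) (by omega)).seq_pow (K' := 60 + 20) fun s1 ⟨hT1, hk1, hx⟩ =>
    ((runs_scan (i := 12) (a := 10) (b := 9) (va := b) (vb := a) hw hT1
    (by rw [hk1 _ (by omega) (by omega), hb])
    (by rw [hk1 _ (by omega) (by omega), ha]) (by omega) (by omega) (by omega) (by omega)
    (by omega)).seq_pow (K' := 20) fun s2 ⟨hT2, hk2, hy⟩ => ?_))
  have hk : ∀ c, c ≠ 6 → c ≠ 11 → c ≠ 12 → s2.reg c = s.reg c := fun c h1 h2 h3 => by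
    rw [hk2 c h3 h1, hk1 c h2 h1]
  rw [← hk2 11 (by omega) (by omega)] at hx
  rw [← hk 8 (by omega) (by omega) (by omega)] at hc
  rw [← hk 9 (by omega) (by omega) (by omega)] at ha
  rw [← hk 10 (by omega) (by omega) (by omega)] at hb
  have h4 := hk 4 (by omega) (by omega) (by omega)
  have h5 := hk 5 (by omega) (by omega) (by omega)
  have htest : ∀ c, (Expr.op .eq (.reg c) (.reg 0)).eval w s2 = if s2.reg c = n then 1 else 0 := by
    intro c
    simp only [Expr.eval, BinOp.eval, hone, hT2.size]
  refine ((Runs.ite (B := 12) (fun h12 => ?_) fun h12 => ?_).mono (fun _ h => h)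
    (by simp [Expr.cost])).to_pow 1 hn
  · rw [htest] at h12
    refine (Runs.skip ⟨hT2, h4, h5, a, b, ha, hb, ?_⟩).mono (fun _ h => h) (by omega)
    rcases hy with ⟨-, hy⟩ | ⟨y, hy, -⟩
    · rcases hc with ⟨h1, h2, h3, h4⟩ | hc | hc
      · exact Or.inr (Or.inl ⟨h1, hy, h4 _ (.win hy)⟩)
      · exact Or.inr (Or.inl hc)
      · exact Or.inr (Or.inr hc)
    · rw [hy, if_neg y.2.ne] at h12
      exact absurd rfl h12
  · rw [htest] at h12
    rcases hy with ⟨hy, -⟩ | ⟨y, hy, hytop⟩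
    · rw [if_pos hy] at h12
      exact absurd h12 one_ne_zero
    refine (Runs.ite (B := 4) (fun h11 => ?_) fun h11 => ?_).mono (fun _ h => h)
      (by simp [Expr.cost])
    · rw [htest] at h11
      refine (Runs.assign ⟨hT2.setReg (by omega), by simpa using h4, by simpa using h5, a, b,
        by simpa using ha, by simpa using hb, ?_⟩).mono (fun _ h => h) (by simp [Expr.cost])
      rcases hx with ⟨-, hx⟩ | ⟨y, hy, -⟩
      · refine Or.inr (Or.inr ⟨by simp [Expr.eval], ?_⟩)
        rcases hc with ⟨-, -, -, h4⟩ | ⟨-, h, -⟩ | ⟨-, h⟩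
        · exact h4 _ (.lose hx hytop.1 hytop.2.1)
        · exact absurd (h y hytop.1) hytop.2.1
        · exact h
      · rw [hy, if_neg y.2.ne] at h11
        exact absurd rfl h11
    · rw [htest] at h11
      rcases hx with ⟨hx, -⟩ | ⟨z, hz, hztop⟩
      · rw [if_pos hx] at h11
        exact absurd h11 one_ne_zero
      refine ((Runs.assign (Q := fun s' => s' = s2.setReg 9 z) (by simp [Expr.eval, hz])).seq
        fun s' hs' => Runs.assign ?_).mono (fun _ h => h) (by simp [Expr.cost])
      subst hs'
      refine ⟨(hT2.setReg (by omega)).setReg (by omega), by simpa using h4, by simpa using h5, z, y,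
        by simp, by simpa [Expr.eval] using hy, ?_⟩
      rcases hc with ⟨h1, h2, h3, h4⟩ | ⟨-, h, -⟩ | ⟨h1, h⟩
      · have e1 := hztop.1.2
        have e2 := hytop.1.2
        exact Or.inl ⟨by simpa using h1, by omega, by omega,
          fun res hres => h4 res (.step hztop hytop hres)⟩
      · exact absurd (h y hytop.1) hytop.2.1
      · exact Or.inr (Or.inr ⟨by simpa using h1, h⟩)

theorem runs_compareVertices (hw : n * n + n + 2 ≤ 2 ^ w) (hG : G.Connected) (hT : Tables G t r x s)
    {v : Fin n} (hv : s.reg 4 = v) (hd : G.dist r v = G.dist r t) :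
    Runs w compareVertices s (fun s' => Tables G t r x s' ∧ s'.reg 4 = v ∧
      ((s'.reg 8 = s.reg 8 ∧ Comparison G r v t true) ∨
        (s'.reg 8 = 0 ∧ Comparison G r v t false))) (160 * n ^ 2) := by
  have hn : 1 ≤ n := Fin.pos r
  have hn1 : n < 2 ^ w := by omega
  have hn2 : 1 < 2 ^ w := by omega
  have hdt : G.dist r t < n := by simpa using hG.dist_lt_card r t
  have hinit : Runs w (.seq (.assign 9 (.reg 4)) (.assign 10 (.reg 1))) s
      (fun s' => s' = (s.setReg 9 v).setReg 10 t) 4 :=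
    (Runs.assign (Q := fun s' => s' = s.setReg 9 v) (by simp [Expr.eval, hv])).seq
      fun s' hs' => Runs.assign (by subst hs'; simp [Expr.eval, hT.target])
  refine ((hinit.to_pow 2 hn).seq_pow (K' := 154) (Q := fun s' => Tables G t r x s' ∧
      s'.reg 5 = n ∧ s'.reg 4 = v ∧ CompareState G t r v (s.reg 8) n s') fun s' hs' => ?_).mono
    (fun s' ⟨h1, _, h3, a, b, _, _, h4⟩ => ⟨h1, h3, ?_⟩) (Nat.mul_le_mul_right _ (by omega))
  · subst hs'
    refine Runs.forLoop (K := 140) (j := 1) hn1 hn2 hn (fun i s' => Tables G t r x s' ∧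
      s'.reg 5 = i ∧ s'.reg 4 = v ∧ CompareState G t r v (s.reg 8) i s')
      ⟨((hT.setReg (by omega)).setReg (by omega)).setReg (by omega), by simp, by simpa using hv,
        v, t, by simp, by simp, Or.inl ⟨by simp, hd, by simpa using hd, fun _ h => h⟩⟩
      (fun k s' h => ⟨h.2.1, h.1.size⟩) fun k hk s' ⟨h1, h2, h3, h4⟩ => ?_
    exact (runs_compareStep hw h1 h4).mono (fun s'' ⟨g1, g2, g3, g4⟩ => ⟨by rw [g3, h2],
      g1.setReg (by omega), by simp, by simp [g2, h3], g4.congr (by simp) (by simp) (by simp)⟩) le_rfl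
  · rcases h4 with ⟨_, _, h, _⟩ | ⟨h, _, h'⟩ | h
    -- Undecided after `n` steps is impossible: each such step climbs one layer, and `t` lies in a
    -- layer below `n`.
    · omega
    · exact Or.inl ⟨h, h'⟩
    · exact Or.inr h

/-! ### The decision procedure -/

/-- Clear register `8` if the vertex in register `4` prevents the vertex in register `1` from being
the last one. -/
def checkVertex : Prog :=
  .ite (.op .eq (.load 1 (.reg 4)) (.load 1 (.reg 1))) compareVertices
    (.ite (.op .lt (.load 1 (.reg 1)) (.load 1 (.reg 4))) (.assign 8 (.const 0)) .skip)

/-- Set register `2` if the vertex in register `1` is the last vertex of an LBFS ordering that starts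
with the vertex in register `3`. -/
def checkRoot : Prog :=
  .seq distances (.seq parents (.seq (.assign 8 (.const 1)) (.seq (forLoop 4 checkVertex)
    (.ite (.reg 8) (.assign 2 (.const 1)) .skip))))

/-- Decide whether the vertex in register `1` is an end vertex of LBFS. -/
def endVertexProgram : Prog :=
  .seq (.assign 2 (.const 0)) (.seq (forLoop 3 checkRoot) (.assign 0 (.reg 2)))

/-- The vertex `v` does not prevent `t` from being the last vertex of an LBFS ordering that starts
with `r`. -/
def Passes (G : SimpleGraph (Fin n)) (t r v : Fin n) : Prop :=
  G.dist r v ≤ G.dist r t ∧ (G.dist r v = G.dist r t → Comparison G r v t true)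

/-- The vertex `v` prevents `t` from being the last vertex of an LBFS ordering that starts
with `r`. -/
def Fails (G : SimpleGraph (Fin n)) (t r v : Fin n) : Prop :=
  G.dist r t < G.dist r v ∨ (G.dist r v = G.dist r t ∧ Comparison G r v t false)

theorem runs_checkVertex (hw : n * n + n + 2 ≤ 2 ^ w) (hG : G.Connected) (hT : Tables G t r x s)
    {v : Fin n} (hv : s.reg 4 = v) :
    Runs w checkVertex s (fun s' => Tables G t r x s' ∧ s'.reg 4 = v ∧
      ((s'.reg 8 = s.reg 8 ∧ Passes G t r v) ∨ (s'.reg 8 = 0 ∧ Fails G t r v))) (180 * n ^ 2) := by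
  have hn : 1 ≤ n := Fin.pos r
  have hone : 1 % 2 ^ w = 1 := Nat.mod_eq_of_lt (by omega)
  have hpow : 1 ≤ n ^ 2 := Nat.one_le_pow _ _ hn
  have htest : (Expr.op .eq (.load 1 (.reg 4)) (.load 1 (.reg 1))).eval w s =
      if G.dist r v = G.dist r t then 1 else 0 := by
    simp only [Expr.eval, BinOp.eval, hone, hv, hT.target, hT.dist]
  have htest2 : (Expr.op .lt (.load 1 (.reg 1)) (.load 1 (.reg 4))).eval w s =
      if G.dist r t < G.dist r v then 1 else 0 := by
    simp only [Expr.eval, BinOp.eval, hone, hv, hT.target, hT.dist]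
  refine (Runs.ite (B := 160 * n ^ 2) (fun hc => ?_) (fun hc => ?_)).mono (fun _ h => h)
    (by simp only [Expr.cost]; omega)
  · rw [htest] at hc
    have hd : G.dist r v = G.dist r t := by by_contra h; rw [if_neg h] at hc; exact hc rfl
    refine (runs_compareVertices hw hG hT hv hd).mono (fun s' ⟨h1, h2, h3⟩ => ⟨h1, h2, ?_⟩) le_rfl
    rcases h3 with ⟨h3, h4⟩ | ⟨h3, h4⟩
    · exact Or.inl ⟨h3, hd.le, fun _ => h4⟩
    · exact Or.inr ⟨h3, Or.inr ⟨hd, h4⟩⟩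
  · rw [htest] at hc
    have hd : G.dist r v ≠ G.dist r t := by intro h; rw [if_pos h] at hc; exact one_ne_zero hc
    refine (Runs.ite (B := 2) (fun hc => ?_) (fun hc => ?_)).mono (fun _ h => h)
      (by simp only [Expr.cost]; omega)
    · rw [htest2] at hc
      have hlt : G.dist r t < G.dist r v := by by_contra h; rw [if_neg h] at hc; exact hc rfl
      exact Runs.assign ⟨hT.setReg (by omega), by simpa using hv,
        Or.inr ⟨by simp [Expr.eval], Or.inl hlt⟩⟩
    · rw [htest2] at hc
      have hlt : ¬ G.dist r t < G.dist r v := by intro h; rw [if_pos h] at hc; exact one_ne_zero hc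
      exact (Runs.skip ⟨hT, hv, Or.inl ⟨rfl, not_lt.1 hlt, fun h => absurd h hd⟩⟩).mono
        (fun _ h => h) (by omega)

theorem runs_checkRoot (hw : n * n + n + 2 ≤ 2 ^ w) (hG : G.Connected) (hF : Frame G t r x s) :
    Runs w checkRoot s (fun s' => ∃ y, Frame G t r y s' ∧
      ((y = 1 ∧ ∀ v, Passes G t r v) ∨ (y = x ∧ ∃ v, Fails G t r v))) (500 * n ^ 3) := by
  have hn : 1 ≤ n := Fin.pos r
  have hn1 : n < 2 ^ w := by omega
  have hn2 : 1 < 2 ^ w := by omega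
  have hone : 1 % 2 ^ w = 1 := Nat.mod_eq_of_lt hn2
  have hloop : ∀ s', (Tables G t r x s' ∧ s'.reg 8 = 1) → Runs w (forLoop 4 checkVertex) s'
      (fun s' => Tables G t r x s' ∧ s'.reg 4 = n ∧
        ((s'.reg 8 = 1 ∧ ∀ v : Fin n, (v : ℕ) < n → Passes G t r v) ∨
          (s'.reg 8 = 0 ∧ ∃ v, Fails G t r v))) (194 * n ^ 3) := by
    rintro s' ⟨h1, h2⟩
    refine Runs.forLoop (K := 180) (j := 2) hn1 hn2 hn (fun k s' => Tables G t r x s' ∧ s'.reg 4 = k ∧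
        ((s'.reg 8 = 1 ∧ ∀ v : Fin n, (v : ℕ) < k → Passes G t r v) ∨
          (s'.reg 8 = 0 ∧ ∃ v, Fails G t r v)))
      ⟨h1.setReg (by omega), by simp, Or.inl ⟨by simpa using h2, by simp⟩⟩
      (fun k s' h => ⟨h.2.1, h.1.size⟩) fun k hk s' ⟨h1, h2, h3⟩ => ?_
    refine (runs_checkVertex hw hG (v := ⟨k, hk⟩) h1 h2).mono (fun s'' ⟨g1, g2, g3⟩ => ⟨g2,
      g1.setReg (by omega), by simp, ?_⟩) le_rfl
    have h8 : (s''.setReg 4 (k + 1)).reg 8 = s''.reg 8 := by simp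
    rw [h8]
    rcases g3 with ⟨g3, g4⟩ | ⟨g3, g4⟩
    · rw [g3]
      refine h3.imp (fun ⟨h3, h4⟩ => ⟨h3, fun v hv => ?_⟩) id
      rcases Nat.lt_succ_iff_lt_or_eq.1 hv with hv | hv
      · exact h4 v hv
      · have : v = ⟨k, hk⟩ := Fin.ext hv
        rw [this]
        exact g4
    · exact Or.inr ⟨g3, _, g4⟩
  refine ((runs_distances hw hG hF).seq_pow (K' := 100 + (2 + (194 + 10))) fun s1 ⟨h1, h2⟩ =>
    ((runs_parents hw h1 h2 hG).pow_mono (K' := 100) (j' := 3) hn le_rfl (by omega)).seq_pow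
    fun s2 hT => ((Runs.assign (Q := fun s' => Tables G t r x s' ∧ s'.reg 8 = 1)
      ⟨hT.setReg (by omega), by simp [Expr.eval, hone]⟩).to_pow 3 hn).seq_pow fun s3 h =>
      (hloop s3 h).seq_pow fun s4 ⟨g1, _, g3⟩ => Runs.to_pow 3 ((Runs.ite (B := 2) (fun hc => ?_)
      fun hc => ?_).mono (fun _ h => h) (by simp [Expr.cost])) hn).mono (fun _ h => h)
      (Nat.mul_le_mul_right _ (by omega))
  · rcases g3 with ⟨-, g4⟩ | ⟨g3, -⟩
    · refine Runs.assign ⟨1, ⟨g1.size, g1.target, by simp [Expr.eval, hone], g1.root, g1.adj,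
        g1.sentinel⟩, Or.inl ⟨rfl, fun v => g4 v v.2⟩⟩
    · exact absurd g3 hc
  · rcases g3 with ⟨g3, -⟩ | ⟨-, g4⟩
    · exact absurd (g3.symm.trans hc) one_ne_zero
    · exact (Runs.skip ⟨x, g1.toFrame, Or.inr ⟨rfl, g4⟩⟩).mono (fun _ h => h) (by omega)

/-- The two implications replace a proof that `Passes` and `Fails` exclude each other: the program
establishes one of the two premises, and each settles the answer. -/
theorem passes_or_fails_sound (hG : G.Connected) (hb : IsChordalBipartite G) :
    ((∃ r, ∀ v, Passes G t r v) → IsLBFSEndVertex G t) ∧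
      ((∀ r, ∃ v, Fails G t r v) → ¬ IsLBFSEndVertex G t) := by
  constructor
  · rintro ⟨r, h⟩
    exact exists_isLBFSOrdering_of_comparison (by simp) hG hb (fun v => (h v).1) fun v => (h v).2
  · rintro h ⟨σ, hσ, ht⟩
    obtain ⟨r, h1, h2⟩ := exists_root_of_isLBFSOrdering hG hb hσ ht
    obtain ⟨v, hv | ⟨hv, hv'⟩⟩ := h r
    · exact absurd hv (h1 v).not_gt
    · exact h2 v hv hv'

theorem graphInput_adj (u v : Fin n) :
    (graphInput G t).mem 0 (u * n + v) = ind (G.Adj u v) := by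
  have h : (0 = 0 ∧ ∃ u' v' : Fin n, G.Adj u' v' ∧ (u : ℕ) * n + v = (u' : ℕ) * n + v') ↔
      G.Adj u v := by
    constructor
    · rintro ⟨-, u', v', ha, he⟩
      rw [matrix_index_inj v.2 v'.2] at he
      rwa [Fin.ext he.1, Fin.ext he.2]
    · exact fun ha => ⟨rfl, u, v, ha, rfl⟩
  rw [← propext h]
  simp only [graphInput, ind]
  congr

theorem runs_endVertexProgram (hw : n * n + n + 2 ≤ 2 ^ w) (hG : G.Connected)
    (hb : IsChordalBipartite G) :
    Runs w endVertexProgram (graphInput G t) (fun s' => s'.reg 0 ≠ 0 ↔ IsLBFSEndVertex G t)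
      (600 * n ^ 4) := by
  have hn : 1 ≤ n := Fin.pos t
  have hn1 : n < 2 ^ w := by omega
  have hn2 : 1 < 2 ^ w := by omega
  -- `Frame` cannot be the invariant here, because register `3` ends with the value `n`, which is
  -- not a vertex.
  have hloop : Runs w (forLoop 3 checkRoot) ((graphInput G t).setReg 2 0)
      (fun s' => s'.reg 0 = n ∧ s'.reg 1 = t ∧ s'.reg 3 = n ∧
        (∀ u v : Fin n, s'.mem 0 (u * n + v) = ind (G.Adj u v)) ∧ s'.mem 2 n = 0 ∧
        ((s'.reg 2 = 1 ∧ ∃ r, ∀ v, Passes G t r v) ∨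
          (s'.reg 2 = 0 ∧ ∀ r : Fin n, (r : ℕ) < n → ∃ v, Fails G t r v))) (514 * n ^ 4) := by
    refine Runs.forLoop (K := 500) (j := 3) hn1 hn2 hn (fun k s' => s'.reg 0 = n ∧ s'.reg 1 = t ∧
        s'.reg 3 = k ∧ (∀ u v : Fin n, s'.mem 0 (u * n + v) = ind (G.Adj u v)) ∧ s'.mem 2 n = 0 ∧
        ((s'.reg 2 = 1 ∧ ∃ r, ∀ v, Passes G t r v) ∨
          (s'.reg 2 = 0 ∧ ∀ r : Fin n, (r : ℕ) < k → ∃ v, Fails G t r v)))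
      ⟨by simp [graphInput], by simp [graphInput], by simp, graphInput_adj (t := t), by simp [graphInput],
        Or.inr ⟨by simp, by simp⟩⟩ (fun k s' h => ⟨h.2.2.1, h.1⟩)
      fun k hk s' ⟨h1, h2, h3, h4, h5, h6⟩ => ?_
    refine (runs_checkRoot (t := t) (r := ⟨k, hk⟩) hw hG ⟨h1, h2, rfl, h3, h4, h5⟩).mono
      (fun s'' ⟨y, g1, g2⟩ => ⟨g1.root, by simpa using g1.size, by simpa using g1.target, by simp,
        g1.adj, g1.sentinel, ?_⟩) le_rfl
    have h8 : (s''.setReg 3 (k + 1)).reg 2 = y := by simp [g1.value]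
    rw [h8]
    rcases g2 with ⟨g2, g3⟩ | ⟨g2, g3⟩
    · exact Or.inl ⟨g2, _, g3⟩
    · rw [g2]
      refine h6.imp id fun ⟨h6, h7⟩ => ⟨h6, fun r hr => ?_⟩
      rcases Nat.lt_succ_iff_lt_or_eq.1 hr with hr | hr
      · exact h7 r hr
      · have : r = ⟨k, hk⟩ := Fin.ext hr
        rw [this]
        exact g3
  refine (((Runs.assign (Q := fun s' => s' = (graphInput G t).setReg 2 0)
    (by simp [Expr.eval])).to_pow 4 hn).seq_pow (K' := 514 + 2) fun s' hs' => (hs' ▸ hloop).seq_pow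
    fun s'' ⟨_, _, _, _, _, h⟩ => (Runs.assign ?_).to_pow 4 hn).mono (fun _ h => h)
    (Nat.mul_le_mul_right _ (by simp [Expr.cost]))
  have hsound := passes_or_fails_sound (t := t) hG hb
  rcases h with ⟨h, h'⟩ | ⟨h, h'⟩
  · simp [Expr.eval, h, hsound.1 h']
  · simp [Expr.eval, h, hsound.2 fun r => h' r r.2]

end WordRAM

theorem mainTheorem2 :
    ∃ (P : WordRAM.Prog) (k C : ℕ), ∀ (n : ℕ) (G : SimpleGraph (Fin n)) (t : Fin n),
      G.Connected → IsChordalBipartite G →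
        ∀ w : ℕ, k * Nat.size n ≤ w →
          ∃ (s : WordRAM.State) (T : ℕ), WordRAM.Exec w P (graphInput G t) s T ∧
            T ≤ C * n ^ 4 ∧ (s.reg 0 ≠ 0 ↔ IsLBFSEndVertex G t) := by
  refine ⟨WordRAM.endVertexProgram, 3, 600, fun n G t hG hb w hw => ?_⟩
  refine WordRAM.runs_endVertexProgram ?_ hG hb
  have hn : 1 ≤ n := Fin.pos t
  have h1 : n + 1 ≤ 2 ^ n.size := Nat.lt_size_self n
  -- Three times the bit length makes room for `(n + 1) ^ 3`, which exceeds all matrix addresses.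
  have h2 : (2 ^ n.size) ^ 3 ≤ 2 ^ w := by
    rw [← pow_mul, mul_comm]
    exact Nat.pow_le_pow_right (by omega) hw
  have h3 : (n + 1) ^ 3 ≤ (2 ^ n.size) ^ 3 := Nat.pow_le_pow_left h1 3
  nlinarith [Nat.mul_le_mul hn hn]
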